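/- **Setting.** A *polynomial pCFG* $\mathcal C$ has a finite set $L$ of locations with an initial location $\ell_{init}$ and a terminal location $\ell_{out}$; real variables $x_1,\dots,x_n$, the first $m$ of which are the output variables ($x^{out}\in\mathbb R^m$ denotes the projection of $x\in\mathbb R^n$); an initial valuation $x_{init}$; and finitely many transitions $\tau$, each with a source location, a probability distribution $Pr_\tau$ on $L$, a guard $G(\tau)$ (a Boolean combination of inequalities between linear expressions), a target variable, and an update (none, a polynomial expression in the variables, or sampling from a probability distribution on $\mathbb R$). In each state exactly one transition is enabled (source equal to the current location, guard satisfied); $\ell_{out}$ has a single transition, an unguarded self-loop without update. $Next(\tau,x)$ is the random valuation after $\tau$ is executed in $x$; the successor location and the successor valuation are sampled independently. This defines a Markov chain started in $(\ell_{init},x_{init})$, with law $\mathbb P^{\mathcal C}$ on runs. $T$ is the first time at which $\ell_{out}$ is reached. The output distribution is $\mu^{\mathcal C}[B]=\mathbb P^{\mathcal C}[\text{a state }(\ell_{out},x)\text{ with }x^{out}\in B\text{ is reached}]$ for Borel $B\subseteq\mathbb R^m$. A state is reachable if some finite path from the initial state ends in it, where sampled values range over the support of the sampled distribution. An invariant $I$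 assigns to each location a predicate such that $x\models I(\ell)$ for every reachable $(\ell,x)$; it is linear if these predicates are Boolean combinations of linear inequalities. Let $f:\mathbb R^m\to\mathbb R$ be Borel. A *UESM* for $f$ in $\mathcal C$ with respect to $I$ is a family of Borel functions $U(\ell,\cdot):\mathbb R^n\to\mathbb R$ such that $U(\ell_{out},x)=0$ whenever $x\models I(\ell_{out})$, and, for every transition $\tau$ with source $\ell$, every $x\models I(\ell)\wedge G(\tau)$ and $N=Next(\tau,x)$, the expectations exist and $$U(\ell,x)\ \ge\ \sum_{\ell'}Pr_\tau(\ell')\,\mathbb E[U(\ell',N)+f(N^{out})]-f(x^{out}).$$ An *LESM* is defined in the same way with $\le$ instead of $\ge$. Let $\mathcal C_1,\mathcal C_2$ be almost-surely terminating polynomial pCFGs with the same number $m$ of output variables, in which all sampled distributions have finite moments of all orders, and let $I_1,I_2$ be linear invariants. For each sampling transition let a linear predicate that holds on the support of the sampled distribution be given. **Algorithm.** The parameters are $d,K\in\mathbb N$. The algorithm imposes on both pCFGs one of the following conditions, whose requirement both pCFGs satisfy: (C1) $T$ is almost surely bounded by a constant; (C4) there are $c_1\in\mathbb R$, $c_2>0$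 with $\mathbb P(T>n)\le c_1e^{-c_2n}$ for all large $n$, and there is $M>0$ such that every variable changes by at most $M$ in every step from a reachable state; (C3) $\mathbb E[T]<\infty$; (C2) no requirement. It fixes polynomial templates of degree at most $d$, with unknown coefficients, for $f$ (in the output variables), for $U(\ell)$ at each location $\ell$ of $\mathcal C_1$ and for $L(\ell)$ at each location $\ell$ of $\mathcal C_2$. It collects * the defining constraints of a UESM for $f$ in $\mathcal C_1$ (for $U$, with respect to $I_1$) and of an LESM for $f$ in $\mathcal C_2$ (for $L$, with respect to $I_2$), with expectations evaluated symbolically through moments; * the constraint $U(\ell^1_{init},x^1_{init})+f((x^1_{init})^{out})<L(\ell^2_{init},x^2_{init})+f((x^2_{init})^{out})$; * under (C2), with an unknown $C>0$: $|U(\ell,x)+f(x^{out})|\le C$ for all locations $\ell$ of $\mathcal C_1$ and $x\models I_1(\ell)$; under (C3), with an unknown $C>0$: $|U(\ell,x)+f(x^{out})-U(\ell',N)-f(N^{out})|\le C$ for all transitions $\tau$ of $\mathcal C_1$ with source $\ell$, all $\ell'$ with $Pr_\tau(\ell')>0$, all $x\models I_1(\ell)\wedge G(\tau)$ and all possible values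 $N$ of $Next(\tau,x)$, where the sampled values range over the given linear description of the support; and in both cases the same constraints for $L$, $I_2$, $\mathcal C_2$; under (C1) and (C4), nothing more. Equalities and absolute values are split into two inequalities, and the predicates are put in disjunctive normal form (with strict inequalities relaxed to non-strict ones), so that each universally quantified constraint becomes a list of constraints $\forall x.\ g_1(x)\ge0\wedge\dots\wedge g_k(x)\ge0\Rightarrow p(x)\ge0$ with linear $g_j$. Each of these is replaced by the polynomial identity $p=\sum_{|\alpha|\le K}\lambda_\alpha\prod_jg_j^{\alpha_j}$, compared coefficientwise, with fresh unknowns $\lambda_\alpha\ge0$ (Handelman's translation). The result is a linear program in the unknown coefficients, $C$ and the $\lambda_\alpha$. If a solution is found, the algorithm answers "Not output-equivalent" and returns the polynomials $f$, $U^1_f$, $L^2_f$ given by the solution; otherwise it answers "Unknown". **Theorem 3 (Correctness of Equivalence Refutation).** Suppose that the algorithm answers "Not output-equivalent" and returns $f$, $U^1_f$, $L^2_f$. Then $\mathcal C_1$ and $\mathcal C_2$ are not output-equivalent, i.e. $\mu^{\mathcal C_1}[B]\ne\mu^{\mathcal C_2}[B]$ for some Borel set $B\subseteq\mathbb R^m$.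 Moreover, $U^1_f$ is a UESM for $f$ in $\mathcal C_1$ with respect to $I_1$, and $L^2_f$ is an LESM for $f$ in $\mathcal C_2$ with respect to $I_2$. -/

import Mathlib

open MeasureTheory ProbabilityTheory

noncomputable section

/-! ### Linear expressions and predicates -/

/-- An affine-linear expression `c + ∑ aᵢ xᵢ` over `n` real variables. -/
structure LinExp (n : ℕ) where
  coeff : Fin n → ℝ
  const : ℝ

namespace LinExp

variable {n k : ℕ}

def eval (e : LinExp n) (x : Fin n → ℝ) : ℝ := e.const + ∑ i, e.coeff i * x i

def toPoly (e : LinExp n) : MvPolynomial (Fin n) ℝ :=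
  MvPolynomial.C e.const + ∑ i, MvPolynomial.C (e.coeff i) * MvPolynomial.X i

def sub (e e' : LinExp n) : LinExp n := ⟨fun i => e.coeff i - e'.coeff i, e.const - e'.const⟩

/-- Rename the variables along `σ`. -/
def rename (σ : Fin n → Fin k) (e : LinExp n) : LinExp k :=
  ⟨fun j => ∑ i, if σ i = j then e.coeff i else 0, e.const⟩

end LinExp

/-- Predicates: Boolean combinations of atomic predicates `E₁ ≤ E₂` (here with linear
expressions). -/
inductive LinPred (n : ℕ) where
  | le (e₁ e₂ : LinExp n)
  | and (p q : LinPred n)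
  | or (p q : LinPred n)
  | not (p : LinPred n)

namespace LinPred

variable {n k : ℕ}

/-- `p.Sat x` is `x ⊨ p`. -/
def Sat : LinPred n → (Fin n → ℝ) → Prop
  | le e₁ e₂, x => e₁.eval x ≤ e₂.eval x
  | and p q, x => p.Sat x ∧ q.Sat x
  | or p q, x => p.Sat x ∨ q.Sat x
  | not p, x => ¬ p.Sat x

def rename (σ : Fin n → Fin k) : LinPred n → LinPred k
  | le e₁ e₂ => le (e₁.rename σ) (e₂.rename σ)
  | and p q => and (p.rename σ) (q.rename σ)
  | or p q => or (p.rename σ) (q.rename σ)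
  | not p => not (p.rename σ)

/-- Disjunctive normal form of `p` (`b = true`) or of its negation (`b = false`): a list of
disjuncts, each a list of linear expressions `g`, standing for the conjunction of the
inequalities `g ≥ 0`.  A strict inequality (negated atom) is relaxed to the non-strict one, so
the normal form is implied by the predicate. -/
def dnf : Bool → LinPred n → List (List (LinExp n))
  | true, le e₁ e₂ => [[e₂.sub e₁]]
  | false, le e₁ e₂ => [[e₁.sub e₂]]
  | true, and p q => (p.dnf true).flatMap fun c => (q.dnf true).map fun c' => c ++ c'
  | false, and p q => p.dnf false ++ q.dnf false
  | true, or p q => p.dnf true ++ q.dnf true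
  | false, or p q => (p.dnf false).flatMap fun c => (q.dnf false).map fun c' => c ++ c'
  | true, not p => p.dnf false
  | false, not p => p.dnf true

theorem measurableSet_sat (p : LinPred n) : MeasurableSet {x | p.Sat x} := by
  induction p with
  | le e₁ e₂ =>
    refine measurableSet_le ?_ ?_ <;> (unfold LinExp.eval; fun_prop)
  | and p q hp hq => exact hp.inter hq
  | or p q hp hq => exact hp.union hq
  | not p hp => exact hp.compl

end LinPred

/-! ### Probabilistic control-flow graphs -/

/-- Update elements: no update, a polynomial expression over the program variables, or a
probability distribution to sample from. -/
inductive UpdateElem (n : ℕ) where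
  | bot
  | expr (p : MvPolynomial (Fin n) ℝ)
  | dist (δ : ProbabilityMeasure ℝ)

/-- A (polynomial) probabilistic control-flow graph whose output variables are the first `m`
of its `nVar` program variables.  Locations and transitions are numbered; the transition `τ`
has source `src τ`, successor distribution `prob τ`, guard `guard τ`, and update `up τ`
consisting of a target variable and an update element. -/
structure PCFG (m : ℕ) where
  nLoc : ℕ
  nVar : ℕ
  out_le : m ≤ nVar
  locInit : Fin nLoc
  xInit : Fin nVar → ℝ
  locOut : Fin nLoc
  nTrans : ℕ
  src : Fin nTrans → Fin nLoc
  prob : Fin nTrans → PMF (Fin nLoc)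
  guard : Fin nTrans → LinPred nVar
  up : Fin nTrans → Fin nVar × UpdateElem nVar
  /-- the guards of the transitions leaving a location cover all valuations -/
  guard_complete : ∀ ℓ x, ∃ τ, src τ = ℓ ∧ (guard τ).Sat x
  /-- guards of distinct transitions leaving the same location are mutually exclusive -/
  guard_exclusive : ∀ τ τ', τ ≠ τ' → src τ = src τ' →
    ∀ x, ¬ ((guard τ).Sat x ∧ (guard τ').Sat x)
  /-- the terminal location has exactly one outgoing transition, an unguarded self-loop
  without update -/
  out_unique : ∃! τ, src τ = locOut
  out_loop : ∀ τ, src τ = locOut →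
    prob τ = PMF.pure locOut ∧ (∀ x, (guard τ).Sat x) ∧ (up τ).2 = UpdateElem.bot

namespace PCFG

variable {m : ℕ} (C : PCFG m)

abbrev Loc : Type := Fin C.nLoc

/-- Variable valuations. -/
abbrev Val : Type := Fin C.nVar → ℝ

/-- States `(ℓ, x)`. -/
abbrev State : Type := C.Loc × C.Val

/-- The index of the `i`-th output variable among the program variables. -/
def outIdx (i : Fin m) : Fin C.nVar := Fin.castLE C.out_le i

/-- The projection `x ↦ x^out` to the output variables. -/
def proj (x : C.Val) : Fin m → ℝ := fun i => x (C.outIdx i)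

/-- The transition `τ` is enabled at the state `s`. -/
def Enabled (τ : Fin C.nTrans) (s : C.State) : Prop := C.src τ = s.1 ∧ (C.guard τ).Sat s.2

theorem existsUnique_enabled (s : C.State) : ∃! τ, C.Enabled τ s := by
  obtain ⟨τ, h⟩ := C.guard_complete s.1 s.2
  refine ⟨τ, h, fun τ' h' => ?_⟩
  by_contra hne
  exact C.guard_exclusive τ' τ hne (h'.1.trans h.1.symm) s.2 ⟨h'.2, h.2⟩

/-- The unique transition enabled at a state. -/
def enabled (s : C.State) : Fin C.nTrans := (C.existsUnique_enabled s).choose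

theorem enabled_spec (s : C.State) : C.Enabled (C.enabled s) s :=
  (C.existsUnique_enabled s).choose_spec.1

theorem enabled_eq_iff (τ : Fin C.nTrans) (s : C.State) : C.enabled s = τ ↔ C.Enabled τ s :=
  ⟨fun h => h ▸ C.enabled_spec s,
    fun h => (C.existsUnique_enabled s).unique (C.enabled_spec s) h⟩

/-- The law of the random vector `Next(τ, x)`. -/
def next (τ : Fin C.nTrans) (x : C.Val) : Measure C.Val :=
  match (C.up τ).2 with
  | .bot => Measure.dirac x
  | .expr p => Measure.dirac (Function.update x (C.up τ).1 (MvPolynomial.eval x p))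
  | .dist δ => (δ : Measure ℝ).map fun a => Function.update x (C.up τ).1 a

/-- The possible values of `Next(τ, x)`: when sampling from `δ`, the values in the support
of `δ`. -/
def nextSupp (τ : Fin C.nTrans) (x : C.Val) : Set C.Val :=
  match (C.up τ).2 with
  | .bot => {x}
  | .expr p => {Function.update x (C.up τ).1 (MvPolynomial.eval x p)}
  | .dist δ => (fun a => Function.update x (C.up τ).1 a) '' (δ : Measure ℝ).support

instance isProbabilityMeasure_next (τ : Fin C.nTrans) (x : C.Val) :
    IsProbabilityMeasure (C.next τ x) := by
  unfold next
  split
  · infer_instance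
  · infer_instance
  · exact Measure.isProbabilityMeasure_map (measurable_update x).aemeasurable

theorem measurable_next (τ : Fin C.nTrans) : Measurable (C.next τ) := by
  unfold next
  split
  · exact Measure.measurable_dirac
  · rename_i p _
    refine Measure.measurable_dirac.comp ?_
    have hp : Measurable fun x : C.Val => MvPolynomial.eval x p :=
      (MvPolynomial.continuous_eval p).measurable
    rw [measurable_pi_iff]
    intro i
    by_cases h : i = (C.up τ).1
    · subst h; simpa using hp
    · simpa [Function.update_of_ne h] using measurable_pi_apply i
  · rename_i δ _
    have hm : Measurable fun q : C.Val × ℝ => Function.update q.1 (C.up τ).1 q.2 := by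
      rw [measurable_pi_iff]
      intro i
      by_cases h : i = (C.up τ).1
      · subst h; simpa using measurable_snd
      · simp only [Function.update_of_ne h]
        exact (measurable_pi_apply i).comp measurable_fst
    refine Measure.measurable_of_measurable_coe _ fun B hB => ?_
    have : ∀ x : C.Val, ((δ : Measure ℝ).map fun a => Function.update x (C.up τ).1 a) B
        = (δ : Measure ℝ)
          (Prod.mk x ⁻¹' ((fun q : C.Val × ℝ => Function.update q.1 (C.up τ).1 q.2) ⁻¹' B)) :=
      fun x => Measure.map_apply (measurable_update x) hB
    simp only [this]
    exact measurable_measure_prodMk_left (hm hB)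

/-- One step of the operational semantics: with `τ` the enabled transition, the successor
location and the successor valuation are sampled independently. -/
def stepMeasure (s : C.State) : Measure C.State :=
  (C.prob (C.enabled s)).toMeasure.prod (C.next (C.enabled s) s.2)

theorem measurable_enabled : Measurable C.enabled := by
  refine measurable_to_countable' fun τ => ?_
  have : C.enabled ⁻¹' {τ} = {s | C.src τ = s.1} ∩ Prod.snd ⁻¹' {x | (C.guard τ).Sat x} := by
    ext s
    simp [C.enabled_eq_iff, Enabled]
  rw [this]
  refine MeasurableSet.inter ?_ (measurable_snd (C.guard τ).measurableSet_sat)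
  exact measurableSet_eq_fun measurable_const measurable_fst

theorem measurable_prob_prod_next (τ : Fin C.nTrans) :
    Measurable fun x : C.Val => (C.prob τ).toMeasure.prod (C.next τ x) := by
  have : IsMarkovKernel (⟨C.next τ, C.measurable_next τ⟩ : Kernel C.Val C.Val) :=
    ⟨fun x => C.isProbabilityMeasure_next τ x⟩
  have hκ : (fun x : C.Val => (C.prob τ).toMeasure.prod (C.next τ x)) =
      ⇑(Kernel.const C.Val (C.prob τ).toMeasure ×ₖ
        (⟨C.next τ, C.measurable_next τ⟩ : Kernel C.Val C.Val)) := by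
    funext x
    rw [Kernel.prod_apply, Kernel.const_apply]
    rfl
  rw [hκ]
  exact Kernel.measurable _

theorem measurable_stepMeasure_coe (B : Set C.State) (hB : MeasurableSet B) :
    Measurable fun s : C.State => C.stepMeasure s B := by
  have h : Measurable fun q : C.Val × Fin C.nTrans =>
      ((C.prob q.2).toMeasure.prod (C.next q.2 q.1)) B :=
    measurable_from_prod_countable_left fun τ =>
      (Measure.measurable_coe hB).comp (C.measurable_prob_prod_next τ)
  have h' : Measurable fun s : C.State => (s.2, C.enabled s) :=
    measurable_snd.prodMk C.measurable_enabled
  have h'' := h.comp h'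
  simp only [Function.comp_def] at h''
  simpa only [stepMeasure] using h''

theorem measurable_stepMeasure : Measurable C.stepMeasure :=
  Measure.measurable_of_measurable_coe _ C.measurable_stepMeasure_coe

/-- The transition kernel of the Markov process defined by the pCFG. -/
def stepKernel : Kernel C.State C.State where
  toFun := C.stepMeasure
  measurable' := C.measurable_stepMeasure

instance isMarkovKernel_stepKernel : IsMarkovKernel C.stepKernel :=
  ⟨fun s => by
    change IsProbabilityMeasure (C.stepMeasure s)
    unfold stepMeasure
    infer_instance⟩

/-- The probability measure over runs: the law of the Markov chain with kernel `stepKernel`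
started in the initial state (on the space of all sequences of states). -/
def runMeasure : Measure (ℕ → C.State) :=
  Kernel.trajMeasure (X := fun _ => C.State) (Measure.dirac (C.locInit, C.xInit))
    fun k => C.stepKernel.comap
      (fun h : (i : Finset.Iic k) → C.State => h ⟨k, Finset.mem_Iic.2 le_rfl⟩)
      (measurable_pi_apply _)

/-- The termination time of a run. -/
def timeTerm (ρ : ℕ → C.State) : ℕ∞ := ⨅ (i : ℕ) (_ : (ρ i).1 = C.locOut), (i : ℕ∞)

/-- Almost-sure termination. -/
def ASTerminating : Prop := ∀ᵐ ρ ∂C.runMeasure, ∃ i, (ρ i).1 = C.locOut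

/-- The event that a run reaches a terminal state with output in `B`. -/
def outputEvent (B : Set (Fin m → ℝ)) : Set (ℕ → C.State) :=
  {ρ | ∃ i x, ρ i = (C.locOut, x) ∧ C.proj x ∈ B}

/-- The output distribution of the pCFG. -/
def outputDist (B : Set (Fin m → ℝ)) : ENNReal := C.runMeasure (C.outputEvent B)

/-- Output equivalence of two pCFGs with the same output variables. -/
def OutputEquivalent (C₁ C₂ : PCFG m) : Prop :=
  ∀ B : Set (Fin m → ℝ), MeasurableSet B → C₁.outputDist B = C₂.outputDist B

/-- `s'` is a successor of `s`. -/
def Succ (s s' : C.State) : Prop :=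
  ∃ τ, C.Enabled τ s ∧ C.prob τ s'.1 ≠ 0 ∧ s'.2 ∈ C.nextSupp τ s.2

/-- Reachability from the initial state by a finite path. -/
def Reachable (s : C.State) : Prop := Relation.ReflTransGen C.Succ (C.locInit, C.xInit) s

/-- A predicate function `I` is an invariant if it contains all reachable states. -/
def IsInvariant (I : C.Loc → LinPred C.nVar) : Prop :=
  ∀ s : C.State, C.Reachable s → (I s.1).Sat s.2

/-- All distributions in sampling instructions have finite absolute moments of all orders. -/
def FiniteMoments : Prop :=
  ∀ τ δ, (C.up τ).2 = UpdateElem.dist δ →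
    ∀ p : ℕ, Integrable (fun a : ℝ => |a| ^ p) (δ : Measure ℝ)

/-! ### Upper and lower expectation supermartingales and submartingales -/

/-- `U` is an upper expectation supermartingale for `f` with respect to `I`.  The expectations
in the defining inequality are required to exist. -/
structure IsUESM (I : C.Loc → LinPred C.nVar) (f : (Fin m → ℝ) → ℝ) (U : C.Loc → C.Val → ℝ) :
    Prop where
  measurable_fun : Measurable f
  measurable_state : ∀ ℓ, Measurable (U ℓ)
  zero_on_output : ∀ x, (I C.locOut).Sat x → U C.locOut x = 0
  integrable : ∀ τ x, (I (C.src τ)).Sat x → (C.guard τ).Sat x → ∀ ℓ', C.prob τ ℓ' ≠ 0 →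
    Integrable (fun y => U ℓ' y + f (C.proj y)) (C.next τ x)
  decrease : ∀ τ x, (I (C.src τ)).Sat x → (C.guard τ).Sat x →
    U (C.src τ) x ≥
      ∑ ℓ', (C.prob τ ℓ').toReal * (∫ y, (U ℓ' y + f (C.proj y)) ∂(C.next τ x)) - f (C.proj x)

/-- `L` is a lower expectation submartingale for `f` with respect to `I`. -/
structure IsLESM (I : C.Loc → LinPred C.nVar) (f : (Fin m → ℝ) → ℝ) (L : C.Loc → C.Val → ℝ) :
    Prop where
  measurable_fun : Measurable f
  measurable_state : ∀ ℓ, Measurable (L ℓ)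
  zero_on_output : ∀ x, (I C.locOut).Sat x → L C.locOut x = 0
  integrable : ∀ τ x, (I (C.src τ)).Sat x → (C.guard τ).Sat x → ∀ ℓ', C.prob τ ℓ' ≠ 0 →
    Integrable (fun y => L ℓ' y + f (C.proj y)) (C.next τ x)
  increase : ∀ τ x, (I (C.src τ)).Sat x → (C.guard τ).Sat x →
    L (C.src τ) x ≤
      ∑ ℓ', (C.prob τ ℓ').toReal * (∫ y, (L ℓ' y + f (C.proj y)) ∂(C.next τ x)) - f (C.proj x)

end PCFG

/-! ### The restrictions on pCFGs imposed by the optional-stopping conditions -/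

/-- The optional-stopping conditions the algorithm can impose. -/
inductive OSTCond where
  | C1 | C2 | C3 | C4

namespace PCFG

variable {m : ℕ} (C : PCFG m)

/-- Along every possible step from a reachable state, each variable changes by at most `M`. -/
def BoundedUpdates : Prop :=
  ∃ M : ℝ, 0 < M ∧ ∀ s s' : C.State, C.Reachable s → C.Succ s s' → ∀ j, |s'.2 j - s.2 j| ≤ M

/-- The restriction on the pCFG under which the algorithm may impose a given condition:
(C1) bounded termination time; (C2) none; (C3) finite expected termination time;
(C4) exponentially decreasing tails of the termination time, and bounded updates. -/
def Admits : OSTCond → Prop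
  | .C1 => ∃ c : ℕ, ∀ᵐ ρ ∂C.runMeasure, C.timeTerm ρ ≤ c
  | .C2 => True
  | .C3 => ∫⁻ ρ, (C.timeTerm ρ : ENNReal) ∂C.runMeasure < ⊤
  | .C4 => C.BoundedUpdates ∧ ∃ c₁ c₂ : ℝ, 0 < c₂ ∧ ∀ᶠ n : ℕ in Filter.atTop,
      C.runMeasure {ρ | (n : ℕ∞) < C.timeTerm ρ} ≤ ENNReal.ofReal (c₁ * Real.exp (-c₂ * n))

/-- `S τ` is a linear description of the values that the transition `τ` can sample:
it holds on the support of the sampled distribution. -/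
def IsSupportDescription (S : Fin C.nTrans → LinPred 1) : Prop :=
  ∀ τ δ, (C.up τ).2 = UpdateElem.dist δ →
    ∀ a ∈ (δ : Measure ℝ).support, (S τ).Sat fun _ => a

end PCFG

/-! ### Templates and symbolic constraints -/

/-- A symbolic polynomial in `n` program variables whose coefficients are linear in the
template variables `T`: the family `p` stands for `∑ u, t u • p u`, where `t u` is the unknown
value of the template variable `u`. -/
abbrev SymPoly (T : Type) (n : ℕ) : Type := T → MvPolynomial (Fin n) ℝ

/-- The polynomial obtained by giving values to the template variables. -/
def SymPoly.inst {T : Type} [Fintype T] {n : ℕ} (p : SymPoly T n) (t : T → ℝ) :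
    MvPolynomial (Fin n) ℝ := ∑ u, t u • p u

/-- Exponent vectors over `n` variables of total degree at most `d`. -/
abbrev Expo (n d : ℕ) : Type := {α : Fin n → Fin (d + 1) // ∑ i, (α i : ℕ) ≤ d}

/-- The monomial with a given exponent vector. -/
def Expo.mono {n d : ℕ} (α : Expo n d) : MvPolynomial (Fin n) ℝ :=
  ∏ i, MvPolynomial.X i ^ (α.1 i : ℕ)

/-- A collected constraint: for all valuations `x`, if `g(x) ≥ 0` for all `g` in `lins`, then
`poly(x) ≥ 0`, with the symbolic polynomial `poly`. -/
structure Entailment (T : Type) where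
  nv : ℕ
  lins : List (LinExp nv)
  poly : SymPoly T nv

/-- The constraints `x ⊨ P ⇒ p(x) ≥ 0`, one for each disjunct of `P`. -/
def entail {T : Type} {n : ℕ} (P : LinPred n) (p : SymPoly T n) : List (Entailment T) :=
  (P.dnf true).map fun c => ⟨n, c, p⟩

namespace PCFG

variable {m : ℕ} (C : PCFG m) {T : Type}

/-- A symbolic polynomial over the output variables, as one over the program variables. -/
def liftOut (f : SymPoly T m) : SymPoly T C.nVar := fun u => MvPolynomial.rename C.outIdx (f u)

/-- Symbolic evaluation of `E[q(Next(τ, x))]` as a polynomial in `x`. In the sampling case the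
powers of the sampled variable are replaced by the moments of the distribution. -/
def expNext (τ : Fin C.nTrans) (q : MvPolynomial (Fin C.nVar) ℝ) : MvPolynomial (Fin C.nVar) ℝ :=
  match (C.up τ).2 with
  | .bot => q
  | .expr p => MvPolynomial.bind₁ (Function.update MvPolynomial.X (C.up τ).1 p) q
  | .dist δ => ∑ μ ∈ q.support,
      MvPolynomial.monomial (μ.erase (C.up τ).1)
        (q.coeff μ * ∫ a : ℝ, a ^ μ (C.up τ).1 ∂(δ : Measure ℝ))

/-- The symbolic polynomial
`η(ℓ, x) + f(x^out) - ∑ Pr(ℓ') E[η(ℓ', N) + f(N^out)]` for a transition `τ` from `ℓ`. -/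
def drift (f : SymPoly T m) (η : C.Loc → SymPoly T C.nVar) (τ : Fin C.nTrans) :
    SymPoly T C.nVar := fun u =>
  η (C.src τ) u + C.liftOut f u
    - ∑ ℓ', (C.prob τ ℓ').toReal • C.expNext τ (η ℓ' u + C.liftOut f u)

/-- Zero on output; the equality is encoded by two inequalities. -/
def zeroConstraints (I : C.Loc → LinPred C.nVar) (η : C.Loc → SymPoly T C.nVar) :
    List (Entailment T) :=
  entail (I C.locOut) (η C.locOut) ++ entail (I C.locOut) (-η C.locOut)

/-- The defining constraints of a UESM. -/
def uesmConstraints (I : C.Loc → LinPred C.nVar) (f : SymPoly T m)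
    (η : C.Loc → SymPoly T C.nVar) : List (Entailment T) :=
  C.zeroConstraints I η ++ (List.finRange C.nTrans).flatMap fun τ =>
    entail ((I (C.src τ)).and (C.guard τ)) (C.drift f η τ)

/-- The defining constraints of an LESM. -/
def lesmConstraints (I : C.Loc → LinPred C.nVar) (f : SymPoly T m)
    (η : C.Loc → SymPoly T C.nVar) : List (Entailment T) :=
  C.zeroConstraints I η ++ (List.finRange C.nTrans).flatMap fun τ =>
    entail ((I (C.src τ)).and (C.guard τ)) (-C.drift f η τ)

/-- The constraints `|η(ℓ, x) + f(x^out)| ≤ c` for `x ⊨ I(ℓ)`; the absolute value is encoded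
by two inequalities. -/
def boundConstraints (I : C.Loc → LinPred C.nVar) (f : SymPoly T m)
    (η : C.Loc → SymPoly T C.nVar) (c : SymPoly T C.nVar) : List (Entailment T) :=
  (List.finRange C.nLoc).flatMap fun ℓ =>
    entail (I ℓ) (c - (η ℓ + C.liftOut f)) ++ entail (I ℓ) (c + (η ℓ + C.liftOut f))

/-- The values of `Next(τ, x)` as polynomials in the program variables and one additional (last)
variable, which stands for the sampled value (and is not used if `τ` does not sample). -/
def nextPoly (τ : Fin C.nTrans) : Fin C.nVar → MvPolynomial (Fin (C.nVar + 1)) ℝ :=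
  match (C.up τ).2 with
  | .bot => fun i => MvPolynomial.X i.castSucc
  | .expr p => Function.update (fun i => MvPolynomial.X i.castSucc) (C.up τ).1
      (MvPolynomial.rename Fin.castSucc p)
  | .dist _ => Function.update (fun i => MvPolynomial.X i.castSucc) (C.up τ).1
      (MvPolynomial.X (Fin.last C.nVar))

/-- `x ⊨ I(ℓ) ∧ G(τ)`, and the additional variable is in the described support. -/
def stepPred (I : C.Loc → LinPred C.nVar) (S : Fin C.nTrans → LinPred 1) (τ : Fin C.nTrans) :
    LinPred (C.nVar + 1) :=
  match (C.up τ).2 with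
  | .bot => ((I (C.src τ)).and (C.guard τ)).rename Fin.castSucc
  | .expr _ => ((I (C.src τ)).and (C.guard τ)).rename Fin.castSucc
  | .dist _ => (((I (C.src τ)).and (C.guard τ)).rename Fin.castSucc).and
      ((S τ).rename fun _ => Fin.last C.nVar)

/-- The symbolic one-step change `η(ℓ, x) + f(x^out) - η(ℓ', N) - f(N^out)`. -/
def changePoly (f : SymPoly T m) (η : C.Loc → SymPoly T C.nVar) (τ : Fin C.nTrans)
    (ℓ' : C.Loc) : SymPoly T (C.nVar + 1) := fun u =>
  MvPolynomial.rename Fin.castSucc (η (C.src τ) u + C.liftOut f u)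
    - MvPolynomial.bind₁ (C.nextPoly τ) (η ℓ' u + C.liftOut f u)

open Classical in
/-- The constraints that the one-step change is at most `c` in absolute value, for all
transitions `τ` and locations `ℓ'` with `Pr(ℓ') > 0`. -/
def changeConstraints (I : C.Loc → LinPred C.nVar) (S : Fin C.nTrans → LinPred 1)
    (f : SymPoly T m) (η : C.Loc → SymPoly T C.nVar) (c : SymPoly T (C.nVar + 1)) :
    List (Entailment T) :=
  (List.finRange C.nTrans).flatMap fun τ =>
    ((List.finRange C.nLoc).filter fun ℓ' => C.prob τ ℓ' ≠ 0).flatMap fun ℓ' =>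
      entail (C.stepPred I S τ) (c - C.changePoly f η τ ℓ') ++
        entail (C.stepPred I S τ) (c + C.changePoly f η τ ℓ')

end PCFG

/-! ### Linear programs and the Handelman translation -/

/-- The relation of a linear constraint. -/
inductive LinRel where
  | eq | ge | gt

/-- A linear constraint `∑ v, coeff v * t v ⋈ rhs` over the unknowns `V`. -/
structure LinConstraint (V : Type) where
  coeff : V → ℝ
  rel : LinRel
  rhs : ℝ

def LinConstraint.Holds {V : Type} [Fintype V] (c : LinConstraint V) (t : V → ℝ) : Prop :=
  match c.rel with
  | .eq => ∑ v, c.coeff v * t v = c.rhs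
  | .ge => ∑ v, c.coeff v * t v ≥ c.rhs
  | .gt => ∑ v, c.coeff v * t v > c.rhs

/-- Auxiliary unknowns: one multiplier for each collected constraint and each product of at
most `K` of its linear expressions. -/
abbrev AuxVar {T : Type} (es : List (Entailment T)) (K : ℕ) : Type :=
  Σ i : Fin es.length, Expo (es.get i).lins.length K

/-- The product of linear expressions belonging to an auxiliary unknown. -/
def handelmanProd {T : Type} {es : List (Entailment T)} {K : ℕ} (a : AuxVar es K) :
    MvPolynomial (Fin (es.get a.1).nv) ℝ :=
  ∏ j, ((es.get a.1).lins.get j).toPoly ^ (a.2.1 j : ℕ)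

open Classical in
/-- The row of the linear program that equates the coefficients of the monomial `μ` in
`poly = ∑ λ_α ∏ g_j ^ α_j`, for the `i`-th collected constraint. -/
def handelmanRow {T : Type} (es : List (Entailment T)) (K : ℕ) (i : Fin es.length)
    (μ : Fin (es.get i).nv →₀ ℕ) : LinConstraint (T ⊕ AuxVar es K) where
  coeff
    | .inl u => ((es.get i).poly u).coeff μ
    | .inr a => if h : i = a.1 then -(handelmanProd a).coeff (h ▸ μ) else 0
  rel := .eq
  rhs := 0

open Classical in
/-- The unknown `v` is nonnegative, respectively positive. -/
def signRow {V : Type} (v : V) (r : LinRel) : LinConstraint V := ⟨Pi.single v 1, r, 0⟩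

/-- The linear constraints obtained from the collected constraints by Handelman's theorem: each
symbolic polynomial is a nonnegative combination of products of at most `K` of its linear
expressions. -/
def handelmanLP {T : Type} (es : List (Entailment T)) (K : ℕ) :
    Set (LinConstraint (T ⊕ AuxVar es K)) :=
  {c | ∃ i μ, c = handelmanRow es K i μ} ∪ {c | ∃ a, c = signRow (Sum.inr a) .ge}

/-! ### The algorithm -/

section Algorithm

variable {m : ℕ} (C₁ C₂ : PCFG m) (d : ℕ)

/-- The template variables: the coefficients of `f`, of `U` at each location of `C₁`, and of `L`
at each location of `C₂`, for monomials of degree at most `d`, and the constant of the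
optional-stopping constraints. -/
abbrev TemplateVar : Type :=
  Expo m d ⊕ (C₁.Loc × Expo C₁.nVar d) ⊕ (C₂.Loc × Expo C₂.nVar d) ⊕ Unit

def templateF : SymPoly (TemplateVar C₁ C₂ d) m
  | .inl α => α.mono
  | _ => 0

def templateU (ℓ : C₁.Loc) : SymPoly (TemplateVar C₁ C₂ d) C₁.nVar
  | .inr (.inl (ℓ', α)) => if ℓ' = ℓ then α.mono else 0
  | _ => 0

def templateL (ℓ : C₂.Loc) : SymPoly (TemplateVar C₁ C₂ d) C₂.nVar
  | .inr (.inr (.inl (ℓ', α))) => if ℓ' = ℓ then α.mono else 0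
  | _ => 0

def templateC (n : ℕ) : SymPoly (TemplateVar C₁ C₂ d) n
  | .inr (.inr (.inr _)) => 1
  | _ => 0

variable (I₁ : C₁.Loc → LinPred C₁.nVar) (I₂ : C₂.Loc → LinPred C₂.nVar)
  (S₁ : Fin C₁.nTrans → LinPred 1) (S₂ : Fin C₂.nTrans → LinPred 1)

/-- The optional-stopping constraints. -/
def ostConstraints : OSTCond → List (Entailment (TemplateVar C₁ C₂ d))
  | .C1 => []
  | .C4 => []
  | .C2 =>
      C₁.boundConstraints I₁ (templateF C₁ C₂ d) (templateU C₁ C₂ d) (templateC C₁ C₂ d _) ++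
      C₂.boundConstraints I₂ (templateF C₁ C₂ d) (templateL C₁ C₂ d) (templateC C₁ C₂ d _)
  | .C3 =>
      C₁.changeConstraints I₁ S₁ (templateF C₁ C₂ d) (templateU C₁ C₂ d)
        (templateC C₁ C₂ d _) ++
      C₂.changeConstraints I₂ S₂ (templateF C₁ C₂ d) (templateL C₁ C₂ d) (templateC C₁ C₂ d _)

/-- All collected constraints of entailment form. -/
def collected (cond : OSTCond) : List (Entailment (TemplateVar C₁ C₂ d)) :=
  C₁.uesmConstraints I₁ (templateF C₁ C₂ d) (templateU C₁ C₂ d) ++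
  C₂.lesmConstraints I₂ (templateF C₁ C₂ d) (templateL C₁ C₂ d) ++
  ostConstraints C₁ C₂ d I₁ I₂ S₁ S₂ cond

/-- The equivalence refutation constraint
`U(ℓ_init¹, x_init¹) + f((x_init¹)^out) < L(ℓ_init², x_init²) + f((x_init²)^out)`. -/
def refutationRow (A : Type) : LinConstraint (TemplateVar C₁ C₂ d ⊕ A) where
  coeff
    | .inl u =>
        MvPolynomial.eval C₂.xInit
          (templateL C₁ C₂ d C₂.locInit u + C₂.liftOut (templateF C₁ C₂ d) u)
        - MvPolynomial.eval C₁.xInit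
          (templateU C₁ C₂ d C₁.locInit u + C₁.liftOut (templateF C₁ C₂ d) u)
    | .inr _ => 0
  rel := .gt
  rhs := 0

/-- The constraint `C > 0` on the symbolic constant, collected under (C2) and (C3). -/
def constantRows (A : Type) : OSTCond → Set (LinConstraint (TemplateVar C₁ C₂ d ⊕ A))
  | .C1 => ∅
  | .C4 => ∅
  | .C2 => {signRow (Sum.inl (Sum.inr (Sum.inr (Sum.inr ())))) .gt}
  | .C3 => {signRow (Sum.inl (Sum.inr (Sum.inr (Sum.inr ())))) .gt}

variable (K : ℕ) (cond : OSTCond)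

/-- The unknowns of the linear program. -/
abbrev Unknown : Type :=
  TemplateVar C₁ C₂ d ⊕ AuxVar (collected C₁ C₂ d I₁ I₂ S₁ S₂ cond) K

/-- The linear program that the algorithm passes to the solver. -/
def algorithmLP : Set (LinConstraint (Unknown C₁ C₂ d I₁ I₂ S₁ S₂ K cond)) :=
  handelmanLP (collected C₁ C₂ d I₁ I₂ S₁ S₂ cond) K ∪
    {refutationRow C₁ C₂ d _} ∪ constantRows C₁ C₂ d _ cond

/-- `t` is a solution of the linear program. -/
def SolvesLP (t : Unknown C₁ C₂ d I₁ I₂ S₁ S₂ K cond → ℝ) : Prop :=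
  ∀ c ∈ algorithmLP C₁ C₂ d I₁ I₂ S₁ S₂ K cond, c.Holds t

/-- The possible answers of the algorithm. -/
inductive Answer where
  | notOutputEquivalent (f : MvPolynomial (Fin m) ℝ)
      (U : C₁.Loc → MvPolynomial (Fin C₁.nVar) ℝ) (L : C₂.Loc → MvPolynomial (Fin C₂.nVar) ℝ)
  | unknown

/-- The input/output relation of the equivalence refutation algorithm, with template degree `d`
and degree `K` of the Handelman products.  It imposes a condition `cond` whose restrictions both
pCFGs satisfy, and passes the linear program to a solver.  If a solution is found, then it
answers "Not output-equivalent" and returns the `f`, `U` and `L` that the solution describes;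
otherwise it answers "Unknown". -/
inductive AlgorithmReturns : Answer C₁ C₂ → Prop where
  | success (cond : OSTCond) (h₁ : C₁.Admits cond) (h₂ : C₂.Admits cond)
      (t : Unknown C₁ C₂ d I₁ I₂ S₁ S₂ K cond → ℝ)
      (ht : SolvesLP C₁ C₂ d I₁ I₂ S₁ S₂ K cond t) :
      AlgorithmReturns (.notOutputEquivalent
        ((templateF C₁ C₂ d).inst (t ∘ Sum.inl))
        (fun ℓ => (templateU C₁ C₂ d ℓ).inst (t ∘ Sum.inl))
        (fun ℓ => (templateL C₁ C₂ d ℓ).inst (t ∘ Sum.inl)))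
  | failure (cond : OSTCond) (h₁ : C₁.Admits cond) (h₂ : C₂.Admits cond)
      (hno : ¬ ∃ t, SolvesLP C₁ C₂ d I₁ I₂ S₁ S₂ K cond t) :
      AlgorithmReturns .unknown

end Algorithm

end

/-! The returned polynomials satisfy two expectation bounds that would clash if the output laws
agreed. Write `Y n` for the value of `U + f` at the `n`-th state of a run of the first pCFG. The
UESM inequality says that `Y` is a supermartingale. Since the terminal location is absorbing and `U`
vanishes there, `Y n` is eventually equal to `f` of the output. If the process is dominated by an
integrable function, passing to the limit gives `E f(output) ≤ Y 0` (`IsUESM.integral_output_le`).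
Negating `f` and `L` gives the opposite bound for the second pCFG (`IsLESM.le_integral_output`).
Equal output laws give equal expectations of `f`, so the initial value for `L` would be at most that
for `U`, which the refutation row forbids.

Two ingredients remain. The first is soundness of the linear program: a nonnegative combination of
products of the `g j` is nonnegative wherever all `g j` are, so the constraints really hold
(`valid_of_handelmanLP`), and symbolic moments agree with true expectations
(`integrable_eval_and_integral_eval`).

The second is domination (`isDominated_of_admits`). Under (C2) the process is bounded outright.
Otherwise it is dominated by its initial absolute value plus the sum of all absolute increments,
which vanish after termination. That sum has finite expectation because only finitely many
increments are nonzero, each integrable (C1), because increments are bounded and `E[T]` is finite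
(C3), or because polynomial growth meets an exponential tail (C4). -/

/-! ### Soundness of the disjunctive normal form and of the Handelman translation -/

namespace LinExp

variable {n k : ℕ}

theorem eval_toPoly (e : LinExp n) (x : Fin n → ℝ) : MvPolynomial.eval x e.toPoly = e.eval x := by
  simp [toPoly, eval]

theorem eval_sub (e e' : LinExp n) (x : Fin n → ℝ) : (e.sub e').eval x = e.eval x - e'.eval x := by
  simp only [sub, eval, sub_mul, Finset.sum_sub_distrib]
  ring

theorem eval_rename (σ : Fin n → Fin k) (e : LinExp n) (x : Fin k → ℝ) :
    (e.rename σ).eval x = e.eval (x ∘ σ) := by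
  simp only [rename, eval, Finset.sum_mul, ite_mul, zero_mul, Function.comp]
  rw [Finset.sum_comm]
  simp

end LinExp

namespace LinPred

variable {n k : ℕ}

theorem sat_rename (σ : Fin n → Fin k) (p : LinPred n) (x : Fin k → ℝ) :
    (p.rename σ).Sat x ↔ p.Sat (x ∘ σ) := by
  induction p with
  | le e₁ e₂ => simp [rename, Sat, LinExp.eval_rename]
  | and p q hp hq => simp [rename, Sat, hp, hq]
  | or p q hp hq => simp [rename, Sat, hp, hq]
  | not p hp => simp [rename, Sat, hp]

/-- Both polarities are proved together because the induction passes through negation. Relaxing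
strict inequalities only enlarges the disjuncts, so coverage is preserved, and coverage is all that
soundness needs. -/
theorem exists_mem_dnf (p : LinPred n) (x : Fin n → ℝ) :
    (p.Sat x → ∃ c ∈ p.dnf true, ∀ g ∈ c, 0 ≤ g.eval x) ∧
      (¬ p.Sat x → ∃ c ∈ p.dnf false, ∀ g ∈ c, 0 ≤ g.eval x) := by
  have product : ∀ {l l' : List (List (LinExp n))},
      (∃ c ∈ l, ∀ g ∈ c, 0 ≤ g.eval x) → (∃ c ∈ l', ∀ g ∈ c, 0 ≤ g.eval x) →
      ∃ c ∈ l.flatMap fun c => l'.map fun c' => c ++ c', ∀ g ∈ c, 0 ≤ g.eval x := by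
    rintro l l' ⟨c, hc, h⟩ ⟨c', hc', h'⟩
    refine ⟨c ++ c', List.mem_flatMap.2 ⟨c, hc, List.mem_map.2 ⟨c', hc', rfl⟩⟩, fun g hg => ?_⟩
    rcases List.mem_append.1 hg with hg | hg
    exacts [h g hg, h' g hg]
  have left : ∀ {l l' : List (List (LinExp n))}, (∃ c ∈ l, ∀ g ∈ c, 0 ≤ g.eval x) →
      ∃ c ∈ l ++ l', ∀ g ∈ c, 0 ≤ g.eval x := by
    rintro l l' ⟨c, hc, h⟩
    exact ⟨c, List.mem_append_left _ hc, h⟩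
  have right : ∀ {l l' : List (List (LinExp n))}, (∃ c ∈ l', ∀ g ∈ c, 0 ≤ g.eval x) →
      ∃ c ∈ l ++ l', ∀ g ∈ c, 0 ≤ g.eval x := by
    rintro l l' ⟨c, hc, h⟩
    exact ⟨c, List.mem_append_right _ hc, h⟩
  induction p with
  | le e₁ e₂ =>
    simp only [Sat, dnf, List.mem_singleton, exists_eq_left, forall_eq, LinExp.eval_sub, sub_nonneg]
    exact ⟨id, fun h => (not_le.1 h).le⟩
  | and p q hp hq =>
    refine ⟨fun h => product (hp.1 h.1) (hq.1 h.2), fun h => ?_⟩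
    rcases not_and_or.1 h with h | h
    exacts [left (hp.2 h), right (hq.2 h)]
  | or p q hp hq =>
    refine ⟨fun h => ?_, fun h => ?_⟩
    · rcases h with h | h
      exacts [left (hp.1 h), right (hq.1 h)]
    · exact product (hp.2 fun h' => h (Or.inl h')) (hq.2 fun h' => h (Or.inr h'))
  | not p hp => exact ⟨fun h => hp.2 h, fun h => hp.1 (not_not.1 h)⟩

end LinPred

namespace SymPoly

variable {T : Type} [Fintype T] {n k : ℕ}

theorem inst_add (p q : SymPoly T n) (t : T → ℝ) : (p + q).inst t = p.inst t + q.inst t := by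
  simp [inst, smul_add, Finset.sum_add_distrib]

theorem inst_sub (p q : SymPoly T n) (t : T → ℝ) : (p - q).inst t = p.inst t - q.inst t := by
  simp [inst, smul_sub, Finset.sum_sub_distrib]

theorem inst_neg (p : SymPoly T n) (t : T → ℝ) : (-p).inst t = -p.inst t := by
  simp [inst]

theorem inst_map (φ : MvPolynomial (Fin n) ℝ →ₗ[ℝ] MvPolynomial (Fin k) ℝ) (p : SymPoly T n)
    (t : T → ℝ) : SymPoly.inst (fun u => φ (p u)) t = φ (p.inst t) := by
  simp [inst]

theorem coeff_inst (p : SymPoly T n) (t : T → ℝ) (μ : Fin n →₀ ℕ) :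
    (p.inst t).coeff μ = ∑ u, t u * (p u).coeff μ := by
  simp [inst, MvPolynomial.coeff_sum]

theorem eval_inst (p : SymPoly T n) (t : T → ℝ) (x : Fin n → ℝ) :
    MvPolynomial.eval x (p.inst t) = ∑ u, t u * MvPolynomial.eval x (p u) := by
  simp [inst, MvPolynomial.smul_eval]

end SymPoly

/-- The values `t` of the template variables satisfy the entailment. -/
def Entailment.Valid {T : Type} [Fintype T] (t : T → ℝ) (e : Entailment T) : Prop :=
  ∀ x, (∀ g ∈ e.lins, 0 ≤ g.eval x) → 0 ≤ MvPolynomial.eval x (e.poly.inst t)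

theorem nonneg_of_valid_entail {T : Type} [Fintype T] {t : T → ℝ} {n : ℕ} {P : LinPred n}
    {p : SymPoly T n} (h : ∀ e ∈ entail P p, e.Valid t) {x : Fin n → ℝ} (hx : P.Sat x) :
    0 ≤ MvPolynomial.eval x (p.inst t) := by
  obtain ⟨c, hc, hg⟩ := (P.exists_mem_dnf x).1 hx
  exact h ⟨n, c, p⟩ (List.mem_map.2 ⟨c, hc, rfl⟩) x hg

/-- The equality rows, taken over all monomials, are exactly the coefficient comparison of this
identity. -/
theorem poly_eq_of_handelmanLP {T : Type} [Fintype T] {es : List (Entailment T)} {K : ℕ}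
    {t : T ⊕ AuxVar es K → ℝ} (h : ∀ c ∈ handelmanLP es K, c.Holds t) (i : Fin es.length) :
    (es.get i).poly.inst (t ∘ Sum.inl) =
      ∑ α : Expo (es.get i).lins.length K,
        t (Sum.inr ⟨i, α⟩) • handelmanProd (⟨i, α⟩ : AuxVar es K) := by
  ext μ
  have hrow := h (handelmanRow es K i μ) (Or.inl ⟨i, μ, rfl⟩)
  simp only [LinConstraint.Holds, handelmanRow, Fintype.sum_sum_type, Fintype.sum_sigma] at hrow
  -- Only the multipliers belonging to the `i`-th constraint occur in its rows.
  rw [Finset.sum_eq_single i] at hrow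
  · rw [SymPoly.coeff_inst, MvPolynomial.coeff_sum]
    simp only [dite_true, neg_mul, Finset.sum_neg_distrib] at hrow
    rw [add_neg_eq_zero] at hrow
    simp only [MvPolynomial.coeff_smul, smul_eq_mul, Function.comp]
    rw [← Finset.sum_congr rfl fun u _ => mul_comm (((es.get i).poly u).coeff μ) _, hrow]
    exact Finset.sum_congr rfl fun α _ => mul_comm _ _
  · intro j _ hj
    simp [Ne.symm hj]
  · simp

theorem valid_of_handelmanLP {T : Type} [Fintype T] {es : List (Entailment T)} {K : ℕ}
    {t : T ⊕ AuxVar es K → ℝ} (h : ∀ c ∈ handelmanLP es K, c.Holds t) :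
    ∀ e ∈ es, e.Valid (t ∘ Sum.inl) := by
  intro e he
  obtain ⟨i, rfl⟩ := List.mem_iff_get.1 he
  intro x hx
  rw [poly_eq_of_handelmanLP h i, map_sum]
  refine Finset.sum_nonneg fun α _ => ?_
  rw [MvPolynomial.smul_eval]
  refine mul_nonneg ?_ ?_
  · have hs := h _ (Or.inr ⟨⟨i, α⟩, rfl⟩)
    simpa [LinConstraint.Holds, signRow, Pi.single_apply] using hs
  · rw [handelmanProd, map_prod]
    refine Finset.prod_nonneg fun j _ => ?_
    rw [map_pow, LinExp.eval_toPoly]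
    exact pow_nonneg (hx _ (List.get_mem _ _)) _

/-! ### One step of a pCFG -/

namespace PCFG

variable {m : ℕ} (C : PCFG m)

/-- Separating the powers of the overwritten coordinate puts the polynomial in the form in which
`expNext` substitutes moments. -/
theorem eval_update_eq_sum {n : ℕ} (q : MvPolynomial (Fin n) ℝ) (j : Fin n) (x : Fin n → ℝ)
    (a : ℝ) : MvPolynomial.eval (Function.update x j a) q =
      ∑ μ ∈ q.support, q.coeff μ * (∏ i, x i ^ (μ.erase j) i) * a ^ μ j := by
  rw [MvPolynomial.eval_eq']
  refine Finset.sum_congr rfl fun μ _ => ?_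
  rw [mul_assoc, ← Finset.mul_prod_erase Finset.univ _ (Finset.mem_univ j),
    ← Finset.mul_prod_erase Finset.univ (fun i => x i ^ (μ.erase j) i) (Finset.mem_univ j)]
  simp only [Function.update_self, Finsupp.erase_same, pow_zero, one_mul]
  rw [mul_comm (a ^ μ j)]
  congr 2
  refine Finset.prod_congr rfl fun i hi => ?_
  have hij := Finset.ne_of_mem_erase hi
  rw [Function.update_of_ne hij, Finsupp.erase_ne hij]

theorem measurable_eval {n : ℕ} (q : MvPolynomial (Fin n) ℝ) :
    Measurable fun x : Fin n → ℝ => MvPolynomial.eval x q :=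
  (MvPolynomial.continuous_eval q).measurable

/-- In the sampling case the value is a finite combination of powers of the sampled number, so
finiteness of moments gives integrability, and linearity of the integral gives the formula. -/
theorem integrable_eval_and_integral_eval {C : PCFG m} (h : C.FiniteMoments) (τ : Fin C.nTrans)
    (x : C.Val) (q : MvPolynomial (Fin C.nVar) ℝ) :
    Integrable (fun y => MvPolynomial.eval y q) (C.next τ x) ∧
      ∫ y, MvPolynomial.eval y q ∂(C.next τ x) = MvPolynomial.eval x (C.expNext τ q) := by
  have hq := measurable_eval q
  unfold next expNext
  split
  · refine ⟨integrable_dirac (by simp), by simp⟩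
  · rename_i p _
    refine ⟨integrable_dirac (by simp), ?_⟩
    rw [integral_dirac]
    simp only [MvPolynomial.eval, MvPolynomial.eval₂Hom_bind₁]
    congr 2
    funext i
    by_cases hi : i = (C.up τ).1
    · subst hi; simp
    · simp [Function.update_of_ne hi]
  · rename_i δ hδ
    have hpow : ∀ k : ℕ, Integrable (fun a : ℝ => a ^ k) (δ : Measure ℝ) := fun k => by
      have hk := h τ δ hδ k
      simp only [← Real.norm_eq_abs, ← norm_pow] at hk
      exact (integrable_norm_iff (by fun_prop)).1 hk
    have hu : Measurable fun a : ℝ => Function.update x (C.up τ).1 a := measurable_update x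
    rw [integrable_map_measure hq.aestronglyMeasurable hu.aemeasurable,
      integral_map hu.aemeasurable hq.aestronglyMeasurable]
    simp only [Function.comp_def, eval_update_eq_sum]
    refine ⟨integrable_finsetSum _ fun μ _ => (hpow _).const_mul _, ?_⟩
    rw [integral_finsetSum _ fun μ _ => (hpow _).const_mul _, map_sum]
    refine Finset.sum_congr rfl fun μ _ => ?_
    rw [integral_const_mul, MvPolynomial.eval_monomial, Finsupp.prod_fintype _ _ (by simp)]
    ring

/-- The support of a measure on the line has full measure. This links the chain's law to the
path-based notion of reachability, on which invariants are stated. -/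
theorem ae_mem_nextSupp (τ : Fin C.nTrans) (x : C.Val) :
    ∀ᵐ y ∂C.next τ x, y ∈ C.nextSupp τ x := by
  unfold next nextSupp
  split
  · simp
  · simp
  · rename_i δ _
    -- Describing the image by two conditions on coordinates makes its measurability visible.
    have hs : (fun a => Function.update x (C.up τ).1 a) '' (δ : Measure ℝ).support =
        {y | y (C.up τ).1 ∈ (δ : Measure ℝ).support} ∩
          {y | Function.update x (C.up τ).1 (y (C.up τ).1) = y} := by
      ext y
      constructor
      · rintro ⟨a, ha, rfl⟩
        simp [ha]
      · rintro ⟨hy, hy'⟩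
        exact ⟨_, hy, hy'⟩
    have hu : Measurable fun a : ℝ => Function.update x (C.up τ).1 a := measurable_update x
    have hm : MeasurableSet ((fun a => Function.update x (C.up τ).1 a) ''
        (δ : Measure ℝ).support) := by
      rw [hs]
      refine MeasurableSet.inter ?_ ?_
      · exact (measurable_pi_apply _) Measure.isClosed_support.measurableSet
      · exact measurableSet_eq_fun (hu.comp (measurable_pi_apply _)) measurable_id
    refine (ae_map_iff hu.aemeasurable hm).2 ?_
    filter_upwards [Measure.support_mem_ae (μ := (δ : Measure ℝ))] with a ha
    exact ⟨a, ha, rfl⟩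

theorem measurable_update_prod {n : ℕ} (j : Fin n) :
    Measurable fun q : (Fin n → ℝ) × ℝ => Function.update q.1 j q.2 := by
  rw [measurable_pi_iff]
  intro i
  by_cases h : i = j
  · subst h; simpa using measurable_snd
  · simp only [Function.update_of_ne h]
    exact (measurable_pi_apply i).comp measurable_fst

theorem measurableSet_nextSupp (τ : Fin C.nTrans) :
    MeasurableSet {q : C.Val × C.Val | q.2 ∈ C.nextSupp τ q.1} := by
  unfold nextSupp
  split
  · exact measurableSet_eq_fun measurable_snd measurable_fst
  · rename_i p _
    exact measurableSet_eq_fun measurable_snd ((measurable_update_prod (C.up τ).1).comp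
      (measurable_fst.prodMk ((measurable_eval p).comp measurable_fst)))
  · rename_i δ _
    have hs : {q : C.Val × C.Val |
        q.2 ∈ (fun a => Function.update q.1 (C.up τ).1 a) '' (δ : Measure ℝ).support} =
        {q | q.2 (C.up τ).1 ∈ (δ : Measure ℝ).support} ∩
          {q | Function.update q.1 (C.up τ).1 (q.2 (C.up τ).1) = q.2} := by
      ext ⟨x, y⟩
      constructor
      · rintro ⟨a, ha, h⟩
        simp only at h
        subst h
        simp [ha]
      · rintro ⟨hy, hy'⟩
        exact ⟨_, hy, hy'⟩
    rw [hs]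
    have hj : Measurable fun q : C.Val × C.Val => q.2 (C.up τ).1 :=
      (measurable_pi_apply _).comp measurable_snd
    refine MeasurableSet.inter (hj Measure.isClosed_support.measurableSet) ?_
    exact measurableSet_eq_fun ((measurable_update_prod (C.up τ).1).comp
      (measurable_fst.prodMk hj)) measurable_snd

/-- Needed to transfer an almost-sure statement between the joint law of two consecutive states and
the step kernel. -/
theorem measurableSet_succ : MeasurableSet {q : C.State × C.State | C.Succ q.1 q.2} := by
  have : {q : C.State × C.State | C.Succ q.1 q.2} = ⋃ τ : Fin C.nTrans,
      {q | C.enabled q.1 = τ} ∩ ({q | C.prob τ q.2.1 ≠ 0} ∩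
        {q | q.2.2 ∈ C.nextSupp τ q.1.2}) := by
    ext q
    simp [Succ, C.enabled_eq_iff]
  rw [this]
  refine MeasurableSet.iUnion fun τ => MeasurableSet.inter ?_ (MeasurableSet.inter ?_ ?_)
  · exact measurableSet_eq_fun (C.measurable_enabled.comp measurable_fst) measurable_const
  · exact (measurable_fst.comp measurable_snd) (MeasurableSet.of_discrete (s := {ℓ | C.prob τ ℓ ≠ 0}))
  · exact ((measurable_snd.comp measurable_fst).prodMk (measurable_snd.comp measurable_snd))
      (C.measurableSet_nextSupp τ)

theorem ae_succ (s : C.State) : ∀ᵐ s' ∂C.stepKernel s, C.Succ s s' := by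
  have h₁ : ∀ᵐ ℓ ∂(C.prob (C.enabled s)).toMeasure, C.prob (C.enabled s) ℓ ≠ 0 := by
    rw [ae_iff, PMF.toMeasure_apply_eq_zero_iff _ MeasurableSet.of_discrete, Set.disjoint_left]
    intro ℓ hℓ hℓ'
    exact ((PMF.mem_support_iff _ _).1 hℓ) (by simpa using hℓ')
  have h₂ := C.ae_mem_nextSupp (C.enabled s) s.2
  change ∀ᵐ s' ∂((C.prob (C.enabled s)).toMeasure.prod (C.next (C.enabled s) s.2)), C.Succ s s'
  filter_upwards [Measure.quasiMeasurePreserving_fst.ae h₁,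
    Measure.quasiMeasurePreserving_snd.ae h₂] with s' h h'
  exact ⟨C.enabled s, C.enabled_spec s, h, h'⟩

theorem lintegral_stepKernel (s : C.State) {F : C.State → ENNReal} (hF : Measurable F) :
    ∫⁻ s', F s' ∂C.stepKernel s = ∑ ℓ', C.prob (C.enabled s) ℓ' *
      ∫⁻ y, F (ℓ', y) ∂C.next (C.enabled s) s.2 := by
  change ∫⁻ s', F s' ∂((C.prob (C.enabled s)).toMeasure.prod (C.next (C.enabled s) s.2)) = _
  rw [lintegral_prod _ hF.aemeasurable, lintegral_fintype]
  refine Finset.sum_congr rfl fun ℓ' _ => ?_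
  rw [PMF.toMeasure_apply_singleton _ _ (MeasurableSet.singleton _), mul_comm]

theorem integral_stepKernel (s : C.State) {F : C.State → ℝ}
    (hF : Integrable F (C.stepKernel s)) :
    ∫ s', F s' ∂C.stepKernel s = ∑ ℓ', (C.prob (C.enabled s) ℓ').toReal *
      ∫ y, F (ℓ', y) ∂C.next (C.enabled s) s.2 := by
  change Integrable F ((C.prob (C.enabled s)).toMeasure.prod (C.next (C.enabled s) s.2)) at hF
  change ∫ s', F s' ∂((C.prob (C.enabled s)).toMeasure.prod (C.next (C.enabled s) s.2)) = _
  rw [integral_prod _ hF, integral_fintype (Integrable.of_finite)]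
  refine Finset.sum_congr rfl fun ℓ' _ => ?_
  rw [Measure.real, PMF.toMeasure_apply_singleton _ _ (MeasurableSet.singleton _), smul_eq_mul]

end PCFG

/-! ### Runs of a pCFG -/

namespace PCFG

variable {m : ℕ} (C : PCFG m)

instance isProbabilityMeasure_runMeasure : IsProbabilityMeasure C.runMeasure := by
  unfold runMeasure
  infer_instance

/-- The Markov property: the Ionescu-Tulcea kernels depend on the history only through its last
state, so the identity for whole histories can be pushed forward to that state. All one-step facts
about runs come from here. -/
theorem map_runMeasure_pair (n : ℕ) :
    C.runMeasure.map (fun ρ => (ρ n, ρ (n + 1))) =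
      (C.runMeasure.map fun ρ => ρ n) ⊗ₘ C.stepKernel := by
  have hm : Measurable fun h : (i : Finset.Iic n) → C.State => h ⟨n, Finset.mem_Iic.2 le_rfl⟩ :=
    measurable_pi_apply _
  have key := Kernel.map_frestrictLe_trajMeasure_compProd_eq_map_trajMeasure
    (X := fun _ => C.State) (μ₀ := Measure.dirac (C.locInit, C.xInit))
    (κ := fun k => C.stepKernel.comap
      (fun h : (i : Finset.Iic k) → C.State => h ⟨k, Finset.mem_Iic.2 le_rfl⟩)
      (measurable_pi_apply _)) (a := n)
  change C.runMeasure.map (Preorder.frestrictLe n) ⊗ₘ _ = C.runMeasure.map _ at key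
  have hr : Measurable (Preorder.frestrictLe (π := fun _ => C.State) n) :=
    Preorder.measurable_frestrictLe n
  ext B hB
  have hL : C.runMeasure.map (fun ρ => (ρ n, ρ (n + 1))) =
      (C.runMeasure.map fun ρ => (Preorder.frestrictLe n ρ, ρ (n + 1))).map
        (Prod.map (fun h : (i : Finset.Iic n) → C.State =>
          h ⟨n, Finset.mem_Iic.2 le_rfl⟩) id) := by
    rw [Measure.map_map (by fun_prop) (by fun_prop)]
    rfl
  rw [hL, ← key, Measure.map_apply (by fun_prop) hB,
    Measure.compProd_apply ((hm.prodMap measurable_id) hB), Measure.compProd_apply hB,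
    lintegral_map (Kernel.measurable_kernel_prodMk_left ((hm.prodMap measurable_id) hB)) hr,
    lintegral_map (Kernel.measurable_kernel_prodMk_left hB) (measurable_pi_apply n)]
  rfl

theorem ae_run_zero : ∀ᵐ ρ ∂C.runMeasure, ρ 0 = (C.locInit, C.xInit) := by
  set x₀ := (MeasurableEquiv.piUnique fun _ : Finset.Iic 0 => C.State).symm (C.locInit, C.xInit)
    with hx₀
  -- With a Dirac initial law the mixture over starting points collapses to a single trajectory
  -- kernel, whose history up to time 0 is its starting point.
  have hrun : C.runMeasure = Kernel.traj (X := fun _ => C.State) (fun k => C.stepKernel.comap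
      (fun h : (i : Finset.Iic k) → C.State => h ⟨k, Finset.mem_Iic.2 le_rfl⟩)
      (measurable_pi_apply _)) 0 x₀ := by
    have hmap : (Measure.dirac (C.locInit, C.xInit)).map
        (MeasurableEquiv.piUnique fun _ : Finset.Iic 0 => C.State).symm = Measure.dirac x₀ :=
      Measure.map_dirac' (MeasurableEquiv.measurable _) _
    refine Eq.trans ?_ (Measure.dirac_bind (Kernel.measurable _) x₀)
    exact congrArg (fun μ => Measure.bind μ _) hmap
  rw [hrun]
  have h : ∀ᵐ y ∂(Kernel.traj (X := fun _ => C.State) (fun k => C.stepKernel.comap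
      (fun h : (i : Finset.Iic k) → C.State => h ⟨k, Finset.mem_Iic.2 le_rfl⟩)
      (measurable_pi_apply _)) 0 x₀).map (Preorder.frestrictLe 0), y = x₀ := by
    rw [Kernel.traj_map_frestrictLe_apply, Kernel.partialTraj_self, Kernel.id_apply]
    exact (ae_dirac_iff (measurableSet_singleton x₀)).2 rfl
  filter_upwards [ae_of_ae_map (by fun_prop) h] with ρ hρ
  exact congrFun hρ ⟨0, by simp⟩

theorem ae_run_succ : ∀ᵐ ρ ∂C.runMeasure, ∀ n, C.Succ (ρ n) (ρ (n + 1)) := by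
  rw [ae_all_iff]
  intro n
  have h : ∀ᵐ q ∂C.runMeasure.map (fun ρ => (ρ n, ρ (n + 1))), C.Succ q.1 q.2 := by
    rw [map_runMeasure_pair, Measure.ae_compProd_iff C.measurableSet_succ]
    exact Filter.Eventually.of_forall C.ae_succ
  exact ae_of_ae_map (f := fun ρ : ℕ → C.State => (ρ n, ρ (n + 1))) (by fun_prop) h

/-- A run in the sense of the operational semantics: it starts in the initial state, and every
state is a successor of the previous one. -/
def IsRun (ρ : ℕ → C.State) : Prop :=
  ρ 0 = (C.locInit, C.xInit) ∧ ∀ n, C.Succ (ρ n) (ρ (n + 1))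

theorem ae_isRun : ∀ᵐ ρ ∂C.runMeasure, C.IsRun ρ := by
  filter_upwards [C.ae_run_zero, C.ae_run_succ] with ρ h h'
  exact ⟨h, h'⟩

theorem lintegral_run_succ (n : ℕ) {F : C.State × C.State → ENNReal} (hF : Measurable F) :
    ∫⁻ ρ, F (ρ n, ρ (n + 1)) ∂C.runMeasure =
      ∫⁻ ρ, ∫⁻ s', F (ρ n, s') ∂C.stepKernel (ρ n) ∂C.runMeasure := by
  rw [← lintegral_map (f := F) (g := fun ρ : ℕ → C.State => (ρ n, ρ (n + 1))) hF (by fun_prop),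
    map_runMeasure_pair, Measure.lintegral_compProd hF,
    lintegral_map (by fun_prop) (measurable_pi_apply n)]

theorem integral_run_succ (n : ℕ) {F : C.State → ℝ} (hF : Measurable F)
    (hint : Integrable (fun ρ => F (ρ (n + 1))) C.runMeasure) :
    ∫ ρ, F (ρ (n + 1)) ∂C.runMeasure =
      ∫ ρ, ∫ s', F s' ∂C.stepKernel (ρ n) ∂C.runMeasure := by
  have hm : Measurable fun ρ : ℕ → C.State => (ρ n, ρ (n + 1)) := by fun_prop
  have hF' : Measurable fun q : C.State × C.State => F q.2 := hF.comp measurable_snd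
  have h₁ : ∫ ρ, F (ρ (n + 1)) ∂C.runMeasure =
      ∫ q, F q.2 ∂C.runMeasure.map fun ρ => (ρ n, ρ (n + 1)) :=
    (integral_map hm.aemeasurable hF'.aestronglyMeasurable).symm
  have hint' : Integrable (fun q : C.State × C.State => F q.2)
      (C.runMeasure.map fun ρ => (ρ n, ρ (n + 1))) :=
    (integrable_map_measure hF'.aestronglyMeasurable hm.aemeasurable).2 hint
  rw [map_runMeasure_pair] at h₁ hint'
  rw [h₁, Measure.integral_compProd hint', integral_map (measurable_pi_apply n).aemeasurable]
  exact (StronglyMeasurable.integral_kernel_prod_right' (κ := C.stepKernel)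
    hF'.stronglyMeasurable).aestronglyMeasurable

theorem integrable_run_succ_kernel (n : ℕ) {F : C.State → ℝ} (hF : Measurable F)
    (hint : Integrable (fun ρ => F (ρ (n + 1))) C.runMeasure) :
    Integrable (fun ρ => ∫ s', F s' ∂C.stepKernel (ρ n)) C.runMeasure := by
  have hm : Measurable fun ρ : ℕ → C.State => (ρ n, ρ (n + 1)) := by fun_prop
  have hF' : Measurable fun q : C.State × C.State => F q.2 := hF.comp measurable_snd
  have hint' : Integrable (fun q : C.State × C.State => F q.2)
      (C.runMeasure.map fun ρ => (ρ n, ρ (n + 1))) :=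
    (integrable_map_measure hF'.aestronglyMeasurable hm.aemeasurable).2 hint
  rw [map_runMeasure_pair] at hint'
  exact hint'.integral_compProd.comp_measurable (measurable_pi_apply n)

theorem ae_integrable_run_succ (n : ℕ) {F : C.State → ℝ} (hF : Measurable F)
    (hint : Integrable (fun ρ => F (ρ (n + 1))) C.runMeasure) :
    ∀ᵐ ρ ∂C.runMeasure, Integrable F (C.stepKernel (ρ n)) := by
  have hm : Measurable fun ρ : ℕ → C.State => (ρ n, ρ (n + 1)) := by fun_prop
  have hF' : Measurable fun q : C.State × C.State => F q.2 := hF.comp measurable_snd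
  have hint' : Integrable (fun q : C.State × C.State => F q.2)
      (C.runMeasure.map fun ρ => (ρ n, ρ (n + 1))) :=
    (integrable_map_measure hF'.aestronglyMeasurable hm.aemeasurable).2 hint
  rw [map_runMeasure_pair] at hint'
  exact ae_of_ae_map (f := fun ρ : ℕ → C.State => ρ n) (measurable_pi_apply n).aemeasurable
    ((Measure.integrable_compProd_iff hF'.aestronglyMeasurable).1 hint').1

/-! ### Absorption in the terminal location -/

section Paths

variable {C} {ρ : ℕ → C.State}

theorem IsRun.reachable (h : C.IsRun ρ) (n : ℕ) : C.Reachable (ρ n) := by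
  induction n with
  | zero => rw [h.1]; exact Relation.ReflTransGen.refl
  | succ n ih => exact ih.tail (h.2 n)

theorem Succ.eq_of_locOut {s s' : C.State} (h : C.Succ s s') (hs : s.1 = C.locOut) : s' = s := by
  obtain ⟨τ, ⟨hτ, -⟩, hp, hn⟩ := h
  obtain ⟨h₁, -, h₃⟩ := C.out_loop τ (hτ.trans hs)
  rw [h₁] at hp
  simp only [nextSupp, h₃, Set.mem_singleton_iff] at hn
  refine Prod.ext ?_ hn
  rw [hs]
  by_contra hne
  exact hp (by rw [PMF.pure_apply, if_neg hne])

theorem IsRun.eq_of_locOut (h : C.IsRun ρ) {n : ℕ} (hn : (ρ n).1 = C.locOut) {k : ℕ}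
    (hk : n ≤ k) : ρ k = ρ n := by
  induction k, hk using Nat.le_induction with
  | base => rfl
  | succ k _ ih => rw [(h.2 k).eq_of_locOut (by rw [ih, hn]), ih]

/-- By absorption, a run outside the terminal location at time `n` cannot have visited it at any
time up to `n`. -/
theorem IsRun.lt_timeTerm (h : C.IsRun ρ) {n : ℕ} (hn : (ρ n).1 ≠ C.locOut) :
    (n : ℕ∞) < C.timeTerm ρ := by
  have : ((n + 1 : ℕ) : ℕ∞) ≤ C.timeTerm ρ := by
    refine le_iInf₂ fun i hi => ?_
    rw [Nat.cast_le]
    by_contra hlt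
    exact hn (by rw [h.eq_of_locOut hi (by omega), hi])
  exact lt_of_lt_of_le (by exact_mod_cast Nat.lt_succ_self n) this

end Paths

/-! ### Hitting time and law of the output -/

open Classical in
/-- The first time at which a run is in the terminal location (`0` if there is none). -/
noncomputable def hitTime (ρ : ℕ → C.State) : ℕ :=
  if h : ∃ i, (ρ i).1 = C.locOut then Nat.find h else 0

/-- The output of a run. -/
noncomputable def output (ρ : ℕ → C.State) : Fin m → ℝ := C.proj (ρ (C.hitTime ρ)).2

theorem measurable_proj : Measurable C.proj :=
  measurable_pi_lambda _ fun _ => measurable_pi_apply _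

theorem measurableSet_locOut (n : ℕ) :
    MeasurableSet {ρ : ℕ → C.State | (ρ n).1 = C.locOut} :=
  measurableSet_eq_fun (measurable_fst.comp (measurable_pi_apply n)) measurable_const

theorem measurable_hitTime : Measurable C.hitTime := by
  classical
  unfold hitTime
  refine Measurable.dite (s := {ρ : ℕ → C.State | ∃ i, (ρ i).1 = C.locOut})
    (f := fun ρ => Nat.find ρ.2) (g := fun _ => 0) ?_ measurable_const ?_
  · refine measurable_find (p := fun (ρ : {ρ : ℕ → C.State | ∃ i, (ρ i).1 = C.locOut}) i =>
      (ρ.1 i).1 = C.locOut) (fun ρ => ρ.2) fun k => ?_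
    exact measurable_subtype_coe (C.measurableSet_locOut k)
  · simp only [Set.ofPred_exists]
    exact MeasurableSet.iUnion C.measurableSet_locOut

theorem measurable_output : Measurable C.output := by
  have h : Measurable fun q : (ℕ → C.State) × ℕ => q.1 q.2 :=
    measurable_from_prod_countable_left fun n => measurable_pi_apply n
  exact C.measurable_proj.comp
    (measurable_snd.comp (h.comp (measurable_id.prodMk C.measurable_hitTime)))

theorem locOut_hitTime {ρ : ℕ → C.State} (h : ∃ i, (ρ i).1 = C.locOut) :
    (ρ (C.hitTime ρ)).1 = C.locOut := by
  classical
  rw [hitTime, dif_pos h]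
  exact Nat.find_spec h

/-- Any two visits to the terminal location carry the same state, as comparison at the later of the
two times shows. The default value of `hitTime` only matters on the null set of nonterminating runs.
-/
theorem outputDist_eq_map {C : PCFG m} (hterm : C.ASTerminating) {B : Set (Fin m → ℝ)}
    (hB : MeasurableSet B) : C.outputDist B = C.runMeasure.map C.output B := by
  rw [Measure.map_apply C.measurable_output hB]
  refine measure_congr ?_
  filter_upwards [C.ae_isRun, hterm] with ρ hρ ht
  refine propext ⟨?_, fun h => ?_⟩
  · rintro ⟨i, x, hi, hx⟩
    have h₁ : ρ (max i (C.hitTime ρ)) = ρ i := hρ.eq_of_locOut (by rw [hi]) (le_max_left _ _)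
    have h₂ : ρ (max i (C.hitTime ρ)) = ρ (C.hitTime ρ) :=
      hρ.eq_of_locOut (C.locOut_hitTime ht) (le_max_right _ _)
    change C.proj (ρ (C.hitTime ρ)).2 ∈ B
    rwa [← h₂, h₁, hi]
  · exact ⟨C.hitTime ρ, (ρ (C.hitTime ρ)).2, Prod.ext (C.locOut_hitTime ht) rfl, h⟩

end PCFG

/-! ### Integrability of polynomials along runs, and optional stopping -/

namespace PCFG

variable {m : ℕ} {C : PCFG m}

theorem measurable_state_fun {η : C.Loc → C.Val → ℝ} (hη : ∀ ℓ, Measurable (η ℓ)) :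
    Measurable fun s : C.State => η s.1 s.2 :=
  (measurable_from_prod_countable_right (f := fun s : C.State => η s.1 s.2) hη)

/-- Induction on time, for all polynomials at once: the one-step expectation of `q ^ 2` is again a
polynomial `r` in the current state, and `r ≤ 1 + r ^ 2` brings it back to a square. -/
theorem lintegral_eval_sq_ne_top (hmom : C.FiniteMoments) (n : ℕ)
    (q : C.Loc → MvPolynomial (Fin C.nVar) ℝ) :
    ∫⁻ ρ, ENNReal.ofReal (MvPolynomial.eval (ρ n).2 (q (ρ n).1) ^ 2) ∂C.runMeasure ≠ ⊤ := by
  induction n generalizing q with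
  | zero =>
    have : ∀ᵐ ρ ∂C.runMeasure, ENNReal.ofReal (MvPolynomial.eval (ρ 0).2 (q (ρ 0).1) ^ 2) =
        ENNReal.ofReal (MvPolynomial.eval C.xInit (q C.locInit) ^ 2) := by
      filter_upwards [C.ae_run_zero] with ρ h
      rw [h]
    rw [lintegral_congr_ae this]
    simp
  | succ n ih =>
    have hF : Measurable fun s : C.State =>
        ENNReal.ofReal (MvPolynomial.eval s.2 (q s.1) ^ 2) :=
      ((measurable_state_fun fun ℓ => measurable_eval (q ℓ)).pow_const 2).ennreal_ofReal
    rw [C.lintegral_run_succ n (F := fun p => ENNReal.ofReal (MvPolynomial.eval p.2.2 (q p.2.1) ^ 2))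
      (hF.comp measurable_snd)]
    have hpoly : ∀ (ℓ' : C.Loc) (τ : Fin C.nTrans) (x : C.Val),
        ∫⁻ y, ENNReal.ofReal (MvPolynomial.eval y (q ℓ') ^ 2) ∂C.next τ x =
          ENNReal.ofReal (MvPolynomial.eval x (C.expNext τ (q ℓ' ^ 2))) := fun ℓ' τ x => by
      obtain ⟨h₁, h₂⟩ := integrable_eval_and_integral_eval hmom τ x (q ℓ' ^ 2)
      simp only [map_pow] at h₁ h₂
      rw [← h₂, ofReal_integral_eq_lintegral_ofReal h₁
        (Filter.Eventually.of_forall fun y => sq_nonneg _)]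
    -- Successor probabilities are bounded by 1 and the enabled transition is replaced by the sum
    -- over all transitions, so the bound involves finitely many fixed polynomials.
    have hle : ∀ s : C.State,
        ∫⁻ s', ENNReal.ofReal (MvPolynomial.eval s'.2 (q s'.1) ^ 2) ∂C.stepKernel s ≤
          ∑ τ : Fin C.nTrans, ∑ ℓ' : C.Loc,
            (1 + ENNReal.ofReal (MvPolynomial.eval s.2 (C.expNext τ (q ℓ' ^ 2)) ^ 2)) := fun s => by
      rw [C.lintegral_stepKernel s hF]
      refine le_trans (Finset.sum_le_sum fun ℓ' _ => ?_)
        (Finset.single_le_sum (f := fun τ => ∑ ℓ' : C.Loc,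
          (1 + ENNReal.ofReal (MvPolynomial.eval s.2 (C.expNext τ (q ℓ' ^ 2)) ^ 2)))
          (fun _ _ => zero_le) (Finset.mem_univ (C.enabled s)))
      refine (mul_le_of_le_one_left' (PMF.coe_le_one _ _)).trans ?_
      rw [hpoly, ← ENNReal.ofReal_one, ← ENNReal.ofReal_add zero_le_one (sq_nonneg _)]
      refine ENNReal.ofReal_le_ofReal ?_
      nlinarith [sq_nonneg (MvPolynomial.eval s.2 (C.expNext (C.enabled s) (q ℓ' ^ 2)) - 1)]
    refine ne_top_of_le_ne_top ?_ (lintegral_mono fun ρ => hle (ρ n))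
    have hmeas : ∀ (τ : Fin C.nTrans) (ℓ' : C.Loc), Measurable fun ρ : ℕ → C.State =>
        1 + ENNReal.ofReal (MvPolynomial.eval (ρ n).2 (C.expNext τ (q ℓ' ^ 2)) ^ 2) :=
      fun τ ℓ' => ((((measurable_eval _).comp (measurable_snd.comp
        (measurable_pi_apply n))).pow_const 2).ennreal_ofReal).const_add 1
    rw [lintegral_finsetSum _ fun τ _ => Finset.measurable_fun_sum _ fun ℓ' _ => hmeas τ ℓ']
    refine ENNReal.sum_ne_top.2 fun τ _ => ?_
    rw [lintegral_finsetSum _ fun ℓ' _ => hmeas τ ℓ']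
    refine ENNReal.sum_ne_top.2 fun ℓ' _ => ?_
    rw [lintegral_add_left measurable_const]
    refine ENNReal.add_ne_top.2 ⟨by simp, ih fun _ => C.expNext τ (q ℓ' ^ 2)⟩

theorem integrable_eval_run (hmom : C.FiniteMoments) (n : ℕ)
    (q : C.Loc → MvPolynomial (Fin C.nVar) ℝ) :
    Integrable (fun ρ => MvPolynomial.eval (ρ n).2 (q (ρ n).1)) C.runMeasure := by
  have hm : Measurable fun ρ : ℕ → C.State => MvPolynomial.eval (ρ n).2 (q (ρ n).1) :=
    (measurable_state_fun fun ℓ => measurable_eval (q ℓ)).comp (measurable_pi_apply n)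
  have hsq : Integrable (fun ρ => MvPolynomial.eval (ρ n).2 (q (ρ n).1) ^ 2) C.runMeasure := by
    refine (lintegral_ofReal_ne_top_iff_integrable (hm.pow_const 2).aestronglyMeasurable
      (Filter.Eventually.of_forall fun _ => sq_nonneg _)).1 (lintegral_eval_sq_ne_top hmom n q)
  -- Domination by `|y| ≤ 1 + y ^ 2`.
  refine ((integrable_const (1 : ℝ)).add hsq).mono' hm.aestronglyMeasurable
    (Filter.Eventually.of_forall fun ρ => ?_)
  rw [Real.norm_eq_abs, abs_le]
  simp only [Pi.add_apply]
  constructor <;> nlinarith [sq_nonneg (MvPolynomial.eval (ρ n).2 (q (ρ n).1) - 1),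
    sq_nonneg (MvPolynomial.eval (ρ n).2 (q (ρ n).1) + 1)]

/-! ### Dominated processes and optional stopping -/

/-- The process `η(ℓₙ, xₙ) + f(xₙ^out)` along a run. -/
def value (f : (Fin m → ℝ) → ℝ) (η : C.Loc → C.Val → ℝ) (s : C.State) : ℝ :=
  η s.1 s.2 + f (C.proj s.2)

theorem measurable_value {f : (Fin m → ℝ) → ℝ} {η : C.Loc → C.Val → ℝ} (hf : Measurable f)
    (hη : ∀ ℓ, Measurable (η ℓ)) : Measurable (value f η) :=
  (measurable_state_fun hη).add (hf.comp (C.measurable_proj.comp measurable_snd))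

/-- The process is dominated by an integrable function, uniformly in time. -/
def IsDominated (Y : C.State → ℝ) : Prop :=
  ∃ G : (ℕ → C.State) → ℝ, Integrable G C.runMeasure ∧
    ∀ n, ∀ᵐ ρ ∂C.runMeasure, |Y (ρ n)| ≤ G ρ

theorem IsDominated.neg {Y : C.State → ℝ} (h : IsDominated Y) : IsDominated (-Y) := by
  simpa only [IsDominated, Pi.neg_apply, abs_neg] using h

theorem isDominated_of_bound {Y : C.State → ℝ} {c : ℝ} (h : ∀ s, C.Reachable s → |Y s| ≤ c) :
    IsDominated Y :=
  ⟨fun _ => c, integrable_const c, fun n => by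
    filter_upwards [C.ae_isRun] with ρ hρ
    exact h _ (hρ.reachable n)⟩

/-- The dominating function is the initial absolute value plus the total variation along the run, by
telescoping. Tonelli makes the latter integrable, hence almost surely finite. -/
theorem isDominated_of_tsum_increments {Y : C.State → ℝ} (hY : Measurable Y)
    (h : ∑' k : ℕ, ∫⁻ ρ, ‖Y (ρ (k + 1)) - Y (ρ k)‖ₑ ∂C.runMeasure ≠ ⊤) : IsDominated Y := by
  have hYn : ∀ n, Measurable fun ρ : ℕ → C.State => Y (ρ n) :=
    fun n => hY.comp (measurable_pi_apply n)
  have hinc : ∀ k, Measurable fun ρ : ℕ → C.State => ‖Y (ρ (k + 1)) - Y (ρ k)‖ₑ :=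
    fun k => ((hYn _).sub (hYn _)).enorm
  have hS : Measurable fun ρ : ℕ → C.State => ∑' k : ℕ, ‖Y (ρ (k + 1)) - Y (ρ k)‖ₑ :=
    Measurable.tsum hinc
  have hSint : ∫⁻ ρ, ∑' k : ℕ, ‖Y (ρ (k + 1)) - Y (ρ k)‖ₑ ∂C.runMeasure ≠ ⊤ := by
    rwa [lintegral_tsum fun k => (hinc k).aemeasurable]
  refine ⟨fun ρ => |Y (C.locInit, C.xInit)| + (∑' k : ℕ, ‖Y (ρ (k + 1)) - Y (ρ k)‖ₑ).toReal,
    (integrable_const _).add (integrable_toReal_of_lintegral_ne_top hS.aemeasurable hSint),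
    fun n => ?_⟩
  filter_upwards [C.ae_run_zero, ae_lt_top hS hSint] with ρ h₀ hfin
  have hle : ∀ n, ‖Y (ρ n) - Y (ρ 0)‖ₑ ≤
      ∑ k ∈ Finset.range n, ‖Y (ρ (k + 1)) - Y (ρ k)‖ₑ := fun n => by
    rw [← Finset.sum_range_sub (fun k => Y (ρ k)) n]
    exact enorm_sum_le _ _
  have hle' := ENNReal.toReal_mono hfin.ne ((hle n).trans (ENNReal.sum_le_tsum _))
  rw [toReal_enorm, Real.norm_eq_abs] at hle'
  rw [← h₀]
  have := abs_add_le (Y (ρ 0)) (Y (ρ n) - Y (ρ 0))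
  rw [add_sub_cancel] at this
  linarith

theorem integrable_of_isDominated {Y : C.State → ℝ} (hY : Measurable Y) (h : IsDominated Y)
    (n : ℕ) : Integrable (fun ρ => Y (ρ n)) C.runMeasure := by
  obtain ⟨G, hG, hle⟩ := h
  exact hG.mono' (hY.comp (measurable_pi_apply n)).aestronglyMeasurable (hle n)

theorem IsUESM.integral_stepKernel_le {I : C.Loc → LinPred C.nVar} {f : (Fin m → ℝ) → ℝ}
    {U : C.Loc → C.Val → ℝ} (hU : C.IsUESM I f U) {s : C.State} (hs : (I s.1).Sat s.2)
    (hint : Integrable (value f U) (C.stepKernel s)) :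
    ∫ s', value f U s' ∂C.stepKernel s ≤ value f U s := by
  obtain ⟨hsrc, hguard⟩ := C.enabled_spec s
  have hdec := hU.decrease (C.enabled s) s.2 (by rwa [hsrc]) hguard
  rw [C.integral_stepKernel s hint]
  rw [hsrc] at hdec
  simp only [value] at hdec ⊢
  linarith

/-- Expectations along the run are nonincreasing: condition on the current state, which is almost
surely reachable and so satisfies the invariant, and apply the one-step inequality. -/
theorem IsUESM.integral_run_le {I : C.Loc → LinPred C.nVar} (hI : C.IsInvariant I)
    {f : (Fin m → ℝ) → ℝ} {U : C.Loc → C.Val → ℝ} (hU : C.IsUESM I f U)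
    (hint : ∀ n, Integrable (fun ρ => value f U (ρ n)) C.runMeasure) (n : ℕ) :
    ∫ ρ, value f U (ρ n) ∂C.runMeasure ≤ value f U (C.locInit, C.xInit) := by
  have hm : Measurable (value (C := C) f U) := measurable_value hU.measurable_fun hU.measurable_state
  induction n with
  | zero =>
    have : ∀ᵐ ρ ∂C.runMeasure, value f U (ρ 0) = value f U (C.locInit, C.xInit) := by
      filter_upwards [C.ae_run_zero] with ρ h
      rw [h]
    rw [integral_congr_ae this]
    simp
  | succ n ih =>
    refine le_trans ?_ ih
    rw [C.integral_run_succ n hm (hint (n + 1))]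
    refine integral_mono_ae (C.integrable_run_succ_kernel n hm (hint (n + 1))) (hint n) ?_
    filter_upwards [C.ae_isRun, C.ae_integrable_run_succ n hm (hint (n + 1))] with ρ hρ hi
    exact hU.integral_stepKernel_le (hI _ (hρ.reachable n)) hi

theorem ae_tendsto_value (hterm : C.ASTerminating) {I : C.Loc → LinPred C.nVar}
    (hI : C.IsInvariant I) (f : (Fin m → ℝ) → ℝ) {η : C.Loc → C.Val → ℝ}
    (hη : ∀ x, (I C.locOut).Sat x → η C.locOut x = 0) :
    ∀ᵐ ρ ∂C.runMeasure, Filter.Tendsto (fun n => value f η (ρ n)) Filter.atTop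
      (nhds (f (C.output ρ))) := by
  filter_upwards [C.ae_isRun, hterm] with ρ hρ ht
  have hout := C.locOut_hitTime ht
  refine tendsto_const_nhds.congr' ?_
  filter_upwards [Filter.eventually_ge_atTop (C.hitTime ρ)] with n hn
  have hinv := hI _ (hρ.reachable (C.hitTime ρ))
  rw [hρ.eq_of_locOut hout hn, value, output, hout, hη _ (hout ▸ hinv), zero_add]

/-- The optional stopping theorem for UESMs. -/
theorem IsUESM.integral_output_le (hterm : C.ASTerminating) {I : C.Loc → LinPred C.nVar}
    (hI : C.IsInvariant I) {f : (Fin m → ℝ) → ℝ} {U : C.Loc → C.Val → ℝ} (hU : C.IsUESM I f U)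
    (hdom : IsDominated (value (C := C) f U)) :
    ∫ ρ, f (C.output ρ) ∂C.runMeasure ≤ value f U (C.locInit, C.xInit) := by
  have hm : Measurable (value (C := C) f U) := measurable_value hU.measurable_fun hU.measurable_state
  have hint := integrable_of_isDominated hm hdom
  obtain ⟨G, hG, hle⟩ := hdom
  -- Dominated convergence carries the bound from each fixed time to the eventual value `f (C.output
  -- ρ)`.
  refine le_of_tendsto' (tendsto_integral_of_dominated_convergence G
    (fun n => (hint n).aestronglyMeasurable) hG hle
    (ae_tendsto_value hterm hI f hU.zero_on_output)) fun n => hU.integral_run_le hI hint n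

theorem IsLESM.neg {I : C.Loc → LinPred C.nVar} {f : (Fin m → ℝ) → ℝ} {L : C.Loc → C.Val → ℝ}
    (hL : C.IsLESM I f L) : C.IsUESM I (-f) (-L) where
  measurable_fun := hL.measurable_fun.neg
  measurable_state ℓ := (hL.measurable_state ℓ).neg
  zero_on_output x hx := by simp [hL.zero_on_output x hx]
  integrable τ x hx hg ℓ' hℓ' := by
    refine (hL.integrable τ x hx hg ℓ' hℓ').neg.congr (Filter.Eventually.of_forall fun y => ?_)
    simp only [Pi.neg_apply]
    ring
  decrease τ x hx hg := by
    have h := hL.increase τ x hx hg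
    have hn : ∀ ℓ', ∫ y, ((-L) ℓ' y + (-f) (C.proj y)) ∂C.next τ x =
        -∫ y, (L ℓ' y + f (C.proj y)) ∂C.next τ x := fun ℓ' => by
      rw [← integral_neg]
      refine integral_congr_ae (Filter.Eventually.of_forall fun y => ?_)
      simp only [Pi.neg_apply]
      ring
    simp only [hn]
    simp only [mul_neg, Finset.sum_neg_distrib, Pi.neg_apply]
    linarith

/-- The optional stopping theorem for LESMs. -/
theorem IsLESM.le_integral_output (hterm : C.ASTerminating) {I : C.Loc → LinPred C.nVar}
    (hI : C.IsInvariant I) {f : (Fin m → ℝ) → ℝ} {L : C.Loc → C.Val → ℝ} (hL : C.IsLESM I f L)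
    (hdom : IsDominated (value (C := C) f L)) :
    value f L (C.locInit, C.xInit) ≤ ∫ ρ, f (C.output ρ) ∂C.runMeasure := by
  have hv : value (C := C) (-f) (-L) = -value f L := by
    funext s
    simp only [value, Pi.neg_apply]
    ring
  have h := hL.neg.integral_output_le hterm hI (hv ▸ hdom.neg)
  simp only [hv, Pi.neg_apply, integral_neg] at h
  linarith

end PCFG

/-! ### Domination under the optional-stopping conditions -/

/-- Assuming `1 ≤ R` lets the exponents of the summands be raised to a common one. -/
theorem MvPolynomial.exists_abs_eval_le {σ : Type*} (q : MvPolynomial σ ℝ) :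
    ∃ (A : ℝ) (D : ℕ), 0 ≤ A ∧ ∀ (R : ℝ) (x : σ → ℝ), 1 ≤ R → (∀ i, |x i| ≤ R) →
      |MvPolynomial.eval x q| ≤ A * R ^ D := by
  induction q using MvPolynomial.induction_on with
  | C a => exact ⟨|a|, 0, abs_nonneg a, fun R x _ _ => by simp⟩
  | add p q hp hq =>
    obtain ⟨A, D, hA, h⟩ := hp
    obtain ⟨A', D', hA', h'⟩ := hq
    refine ⟨A + A', D + D', by positivity, fun R x hR hx => ?_⟩
    rw [map_add]
    refine (abs_add_le _ _).trans ((add_le_add (h R x hR hx) (h' R x hR hx)).trans ?_)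
    rw [add_mul]
    exact add_le_add
      (mul_le_mul_of_nonneg_left (pow_le_pow_right₀ hR (Nat.le_add_right _ _)) hA)
      (mul_le_mul_of_nonneg_left (pow_le_pow_right₀ hR (Nat.le_add_left _ _)) hA')
  | mul_X p i hp =>
    obtain ⟨A, D, hA, h⟩ := hp
    refine ⟨A, D + 1, hA, fun R x hR hx => ?_⟩
    rw [map_mul, MvPolynomial.eval_X, abs_mul, pow_succ, ← mul_assoc]
    exact mul_le_mul (h R x hR hx) (hx i) (abs_nonneg _) (by positivity)

namespace PCFG

variable {m : ℕ} {C : PCFG m}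

/-- After termination the state is constant, so the increment survives only on the event that the
run is still outside the terminal location. -/
theorem lintegral_increment_le {Y : C.State → ℝ} {c : ℝ} {k : ℕ}
    (h : ∀ ρ, C.IsRun ρ → |Y (ρ (k + 1)) - Y (ρ k)| ≤ c) :
    ∫⁻ ρ, ‖Y (ρ (k + 1)) - Y (ρ k)‖ₑ ∂C.runMeasure ≤
      ENNReal.ofReal c * C.runMeasure {ρ | (ρ k).1 ≠ C.locOut} := by
  have hs : MeasurableSet {ρ : ℕ → C.State | (ρ k).1 ≠ C.locOut} := (C.measurableSet_locOut k).compl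
  rw [← lintegral_indicator_const hs]
  refine lintegral_mono_ae ?_
  filter_upwards [C.ae_isRun] with ρ hρ
  by_cases hk : (ρ k).1 = C.locOut
  · rw [hρ.eq_of_locOut hk (Nat.le_succ k), sub_self, enorm_zero]
    exact zero_le
  · rw [Set.indicator_of_mem (by exact hk), Real.enorm_eq_ofReal_abs]
    exact ENNReal.ofReal_le_ofReal (h ρ hρ)

theorem measure_ne_locOut_le (k : ℕ) :
    C.runMeasure {ρ | (ρ k).1 ≠ C.locOut} ≤ C.runMeasure {ρ | (k : ℕ∞) < C.timeTerm ρ} := by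
  refine measure_mono_ae ?_
  filter_upwards [C.ae_isRun] with ρ hρ hk
  exact hρ.lt_timeTerm hk

theorem isDominated_of_boundedTime (hT : C.Admits .C1) {Y : C.State → ℝ} (hY : Measurable Y)
    (hint : ∀ n, Integrable (fun ρ => Y (ρ n)) C.runMeasure) : IsDominated Y := by
  obtain ⟨c, hc⟩ := hT
  refine isDominated_of_tsum_increments hY ?_
  -- From time `c` on the run is almost surely terminated, so only the increments before `c`
  -- contribute.
  rw [tsum_eq_sum (s := Finset.range c)]
  · exact ENNReal.sum_ne_top.2 fun k _ => ((hint (k + 1)).sub (hint k)).2.ne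
  · intro k hk
    rw [Finset.mem_range, not_lt] at hk
    refine (lintegral_eq_zero_iff' ((hint (k + 1)).sub (hint k)).1.enorm).2 ?_
    filter_upwards [C.ae_isRun, hc] with ρ hρ hT
    have hout : (ρ k).1 = C.locOut := by
      by_contra hne
      exact absurd ((hρ.lt_timeTerm hne).trans_le hT) (by simpa using hk)
    simp [hρ.eq_of_locOut hout (Nat.le_succ k)]

/-- Pointwise, the number of times spent outside the terminal location is at most the termination
time. -/
theorem tsum_measure_ne_locOut_le :
    ∑' k : ℕ, C.runMeasure {ρ | (ρ k).1 ≠ C.locOut} ≤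
      ∫⁻ ρ, (C.timeTerm ρ : ENNReal) ∂C.runMeasure := by
  have hs : ∀ k, MeasurableSet {ρ : ℕ → C.State | (ρ k).1 ≠ C.locOut} :=
    fun k => (C.measurableSet_locOut k).compl
  have h : ∀ k, C.runMeasure {ρ | (ρ k).1 ≠ C.locOut} =
      ∫⁻ ρ, {ρ : ℕ → C.State | (ρ k).1 ≠ C.locOut}.indicator 1 ρ ∂C.runMeasure :=
    fun k => (lintegral_indicator_one (hs k)).symm
  simp only [h]
  rw [← lintegral_tsum fun k => (measurable_one.indicator (hs k)).aemeasurable]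
  refine lintegral_mono_ae ?_
  filter_upwards [C.ae_isRun] with ρ hρ
  by_cases htop : C.timeTerm ρ = ⊤
  · simp [htop]
  · obtain ⟨N, hN⟩ := ENat.ne_top_iff_exists.1 htop
    rw [tsum_eq_sum (s := Finset.range N)]
    · have hone : ∀ k ∈ Finset.range N,
          {ρ : ℕ → C.State | (ρ k).1 ≠ C.locOut}.indicator (1 : (ℕ → C.State) → ENNReal) ρ ≤ 1 :=
        fun k _ => Set.indicator_apply_le' (fun _ => le_rfl) fun _ => zero_le
      refine (Finset.sum_le_sum hone).trans ?_
      simp [← hN]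
    · intro k hk
      rw [Finset.mem_range, not_lt] at hk
      refine Set.indicator_of_notMem (fun hne => ?_) _
      have := hρ.lt_timeTerm hne
      rw [← hN, Nat.cast_lt] at this
      omega

theorem isDominated_of_boundedChange (hT : C.Admits .C3) {Y : C.State → ℝ} (hY : Measurable Y)
    {c : ℝ} (h : ∀ s s', C.Reachable s → C.Succ s s' → |Y s' - Y s| ≤ c) : IsDominated Y := by
  refine isDominated_of_tsum_increments hY (ne_top_of_le_ne_top ?_ (ENNReal.tsum_le_tsum fun k =>
    lintegral_increment_le (c := c) fun ρ hρ => h _ _ (hρ.reachable k) (hρ.2 k)))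
  rw [ENNReal.tsum_mul_left]
  exact ENNReal.mul_ne_top ENNReal.ofReal_ne_top
    (ne_top_of_le_ne_top (ne_of_lt hT) tsum_measure_ne_locOut_le)

theorem exists_abs_var_le (h : C.BoundedUpdates) :
    ∃ R : ℝ, 1 ≤ R ∧ ∀ ρ, C.IsRun ρ → ∀ n j, |(ρ n).2 j| ≤ R * (n + 1) := by
  obtain ⟨M, hM, hstep⟩ := h
  -- The initial size and `n` steps of size at most `M` are both absorbed in `R * (n + 1)`. The
  -- summand 1 only ensures `1 ≤ R`.
  refine ⟨1 + M + ∑ j, |C.xInit j|, ?_, fun ρ hρ n => ?_⟩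
  · have := Finset.sum_nonneg fun j (_ : j ∈ Finset.univ) => abs_nonneg (C.xInit j)
    linarith
  · have hsum := Finset.sum_nonneg fun j (_ : j ∈ Finset.univ) => abs_nonneg (C.xInit j)
    induction n with
    | zero =>
      intro j
      rw [hρ.1]
      have := Finset.single_le_sum (f := fun j => |C.xInit j|) (fun _ _ => abs_nonneg _)
        (Finset.mem_univ j)
      push_cast
      linarith
    | succ n ih =>
      intro j
      have h₁ := hstep _ _ (hρ.reachable n) (hρ.2 n) j
      have h₂ := abs_add_le ((ρ n).2 j) ((ρ (n + 1)).2 j - (ρ n).2 j)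
      rw [add_sub_cancel] at h₂
      have h₃ := ih j
      push_cast
      linarith

theorem exists_abs_eval_run_le (h : C.BoundedUpdates) (q : C.Loc → MvPolynomial (Fin C.nVar) ℝ) :
    ∃ (A : ℝ) (D : ℕ), 0 ≤ A ∧ ∀ ρ, C.IsRun ρ → ∀ n : ℕ,
      |MvPolynomial.eval (ρ n).2 (q (ρ n).1)| ≤ A * ((n : ℝ) + 1) ^ D := by
  obtain ⟨R, hR, hvar⟩ := exists_abs_var_le h
  choose A D hA hq using fun ℓ => (q ℓ).exists_abs_eval_le
  -- Sums over the finitely many locations serve as a common constant and exponent; the base `n + 1`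
  -- is at least 1, so enlarging the exponent is harmless.
  refine ⟨∑ ℓ, A ℓ * R ^ D ℓ, ∑ ℓ, D ℓ,
    Finset.sum_nonneg fun ℓ _ => mul_nonneg (hA ℓ) (by positivity), fun ρ hρ n => ?_⟩
  have hn : (1 : ℝ) ≤ (n : ℝ) + 1 := by linarith [n.cast_nonneg (α := ℝ)]
  refine (hq _ (R * (n + 1)) _ (by nlinarith) (hvar ρ hρ n)).trans ?_
  rw [mul_pow, ← mul_assoc]
  refine mul_le_mul ?_ (pow_le_pow_right₀ hn ?_) (by positivity)
    (Finset.sum_nonneg fun ℓ _ => mul_nonneg (hA ℓ) (by positivity))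
  · exact Finset.single_le_sum (f := fun ℓ => A ℓ * R ^ D ℓ)
      (fun ℓ _ => mul_nonneg (hA ℓ) (by positivity)) (Finset.mem_univ _)
  · exact Finset.single_le_sum (f := D) (fun ℓ _ => Nat.zero_le _) (Finset.mem_univ _)

theorem isDominated_of_exponentialTail (hT : C.Admits .C4)
    (q : C.Loc → MvPolynomial (Fin C.nVar) ℝ) :
    IsDominated fun s : C.State => MvPolynomial.eval s.2 (q s.1) := by
  obtain ⟨hupd, c₁, c₂, hc₂, htail⟩ := hT
  obtain ⟨A, D, hA, hle⟩ := exists_abs_eval_run_le hupd q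
  have hY : Measurable fun s : C.State => MvPolynomial.eval s.2 (q s.1) :=
    measurable_state_fun fun ℓ => measurable_eval (q ℓ)
  set c : ℕ → ℝ := fun k => 2 * A * ((k : ℝ) + 2) ^ D with hc
  have hc0 : ∀ k, 0 ≤ c k := fun k => by positivity
  have hinc : ∀ (k : ℕ) (ρ : ℕ → C.State), C.IsRun ρ →
      |MvPolynomial.eval (ρ (k + 1)).2 (q (ρ (k + 1)).1) -
        MvPolynomial.eval (ρ k).2 (q (ρ k).1)| ≤ c k := fun k ρ hρ => by
    have h₁ := hle ρ hρ (k + 1)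
    have h₂ := hle ρ hρ k
    have h₃ : A * ((k : ℝ) + 1) ^ D ≤ A * ((k : ℝ) + 2) ^ D :=
      mul_le_mul_of_nonneg_left (pow_le_pow_left₀ (by positivity) (by linarith) _) hA
    have h₄ : ((k + 1 : ℕ) : ℝ) + 1 = (k : ℝ) + 2 := by push_cast; ring
    rw [h₄] at h₁
    refine (abs_sub _ _).trans ?_
    simp only [hc]
    linarith
  refine isDominated_of_tsum_increments hY (ne_top_of_le_ne_top ?_ (ENNReal.tsum_le_tsum fun k =>
    lintegral_increment_le (Y := fun s : C.State => MvPolynomial.eval s.2 (q s.1)) (hinc k)))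
  have hsum : Summable fun k : ℕ => c k * C.runMeasure.real {ρ | (ρ k).1 ≠ C.locOut} := by
    -- The comparison series is that of `n ^ D * exp (-c₂ * n)` shifted to `n = k + 2`; the factor
    -- `exp (c₂ * 2)` undoes the shift in the exponential. The absolute value allows for a negative
    -- `c₁`.
    have hexp : Summable fun k : ℕ =>
        2 * A * |c₁| * Real.exp (c₂ * 2) * (((k + 2 : ℕ) : ℝ) ^ D * Real.exp (-c₂ * (k + 2 : ℕ))) :=
      ((summable_nat_add_iff 2).2 (Real.summable_pow_mul_exp_neg_nat_mul D hc₂)).mul_left _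
    refine hexp.of_norm_bounded_eventually_nat ?_
    filter_upwards [htail] with k hk
    have hreal : C.runMeasure.real {ρ | (ρ k).1 ≠ C.locOut} ≤ |c₁| * Real.exp (-c₂ * k) := by
      refine ENNReal.toReal_le_of_le_ofReal (by positivity)
        (((measure_ne_locOut_le k).trans hk).trans (ENNReal.ofReal_le_ofReal ?_))
      exact mul_le_mul_of_nonneg_right (le_abs_self _) (Real.exp_pos _).le
    rw [Real.norm_of_nonneg (mul_nonneg (hc0 k) measureReal_nonneg)]
    refine (mul_le_mul_of_nonneg_left hreal (hc0 k)).trans (le_of_eq ?_)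
    have he : Real.exp (-c₂ * k) = Real.exp (c₂ * 2) * Real.exp (-c₂ * (k + 2 : ℕ)) := by
      rw [← Real.exp_add]
      congr 1
      push_cast
      ring
    rw [he, hc]
    push_cast
    ring
  have heq : ∀ k, ENNReal.ofReal (c k) * C.runMeasure {ρ | (ρ k).1 ≠ C.locOut} =
      ENNReal.ofReal (c k * C.runMeasure.real {ρ | (ρ k).1 ≠ C.locOut}) := fun k => by
    rw [ENNReal.ofReal_mul (hc0 k), ofReal_measureReal]
  simp only [heq]
  rw [← ENNReal.ofReal_tsum_of_nonneg (fun k => mul_nonneg (hc0 k) measureReal_nonneg) hsum]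
  exact ENNReal.ofReal_ne_top

theorem isDominated_of_admits (hmom : C.FiniteMoments) {cond : OSTCond} (hT : C.Admits cond)
    (q : C.Loc → MvPolynomial (Fin C.nVar) ℝ)
    (h₂ : cond = .C2 → ∃ c, ∀ s : C.State, C.Reachable s →
      |MvPolynomial.eval s.2 (q s.1)| ≤ c)
    (h₃ : cond = .C3 → ∃ c, ∀ s s' : C.State, C.Reachable s → C.Succ s s' →
      |MvPolynomial.eval s'.2 (q s'.1) - MvPolynomial.eval s.2 (q s.1)| ≤ c) :
    IsDominated fun s : C.State => MvPolynomial.eval s.2 (q s.1) := by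
  have hY : Measurable fun s : C.State => MvPolynomial.eval s.2 (q s.1) :=
    measurable_state_fun fun ℓ => measurable_eval (q ℓ)
  cases cond with
  | C1 => exact isDominated_of_boundedTime hT hY fun n => integrable_eval_run hmom n q
  | C2 =>
    obtain ⟨c, hc⟩ := h₂ rfl
    exact isDominated_of_bound hc
  | C3 =>
    obtain ⟨c, hc⟩ := h₃ rfl
    exact isDominated_of_boundedChange hT hY hc
  | C4 => exact isDominated_of_exponentialTail hT q

end PCFG

/-! ### Meaning of the symbolic constraints -/

namespace PCFG

variable {m : ℕ} {C : PCFG m} {T : Type} [Fintype T] {t : T → ℝ}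

theorem inst_liftOut (f : SymPoly T m) :
    (C.liftOut f).inst t = MvPolynomial.rename C.outIdx (f.inst t) :=
  SymPoly.inst_map (MvPolynomial.rename C.outIdx).toLinearMap f t

theorem eval_inst_liftOut (f : SymPoly T m) (x : C.Val) :
    MvPolynomial.eval x ((C.liftOut f).inst t) = MvPolynomial.eval (C.proj x) (f.inst t) := by
  rw [inst_liftOut, MvPolynomial.eval_rename]
  rfl

theorem eval_inst_add_liftOut (f : SymPoly T m) (p : SymPoly T C.nVar) (x : C.Val) :
    MvPolynomial.eval x ((p + C.liftOut f).inst t) =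
      MvPolynomial.eval x (p.inst t) + MvPolynomial.eval (C.proj x) (f.inst t) := by
  rw [SymPoly.inst_add, map_add, eval_inst_liftOut]

/-- The symbolic drift is formed separately for each template variable, while `expNext` is a sum
over the support of its argument, where linearity is not apparent. Linearity is therefore taken from
the integral. -/
theorem eval_inst_drift (hmom : C.FiniteMoments) (f : SymPoly T m)
    (η : C.Loc → SymPoly T C.nVar) (τ : Fin C.nTrans) (x : C.Val) :
    MvPolynomial.eval x ((C.drift f η τ).inst t) =
      MvPolynomial.eval x ((η (C.src τ)).inst t) + MvPolynomial.eval (C.proj x) (f.inst t) -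
        ∑ ℓ', (C.prob τ ℓ').toReal * ∫ y, (MvPolynomial.eval y ((η ℓ').inst t) +
          MvPolynomial.eval (C.proj y) (f.inst t)) ∂C.next τ x := by
  simp only [← eval_inst_add_liftOut]
  have hint : ∀ ℓ', ∫ y, MvPolynomial.eval y ((η ℓ' + C.liftOut f).inst t) ∂C.next τ x =
      ∑ u, t u * MvPolynomial.eval x (C.expNext τ (η ℓ' u + C.liftOut f u)) := fun ℓ' => by
    simp only [SymPoly.eval_inst, Pi.add_apply]
    rw [integral_finsetSum _ fun u _ =>
      (integrable_eval_and_integral_eval hmom τ x _).1.const_mul _]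
    refine Finset.sum_congr rfl fun u _ => ?_
    rw [integral_const_mul, (integrable_eval_and_integral_eval hmom τ x _).2]
  simp only [hint]
  simp only [SymPoly.eval_inst, drift, Pi.add_apply, map_sub, map_sum, mul_sub,
    Finset.sum_sub_distrib, Finset.mul_sum, MvPolynomial.smul_eval]
  congr 1
  rw [Finset.sum_comm]
  exact Finset.sum_congr rfl fun _ _ => Finset.sum_congr rfl fun _ _ => by ring

theorem eval_inst_eq_zero {I : C.Loc → LinPred C.nVar} {η : C.Loc → SymPoly T C.nVar}
    (h : ∀ e ∈ C.zeroConstraints I η, e.Valid t) {x : C.Val} (hx : (I C.locOut).Sat x) :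
    MvPolynomial.eval x ((η C.locOut).inst t) = 0 := by
  have h₁ := nonneg_of_valid_entail (fun e he => h e (List.mem_append_left _ he)) hx
  have h₂ := nonneg_of_valid_entail (fun e he => h e (List.mem_append_right _ he)) hx
  rw [SymPoly.inst_neg, map_neg] at h₂
  linarith

theorem integrable_eval_inst (hmom : C.FiniteMoments) (f : SymPoly T m) (p : SymPoly T C.nVar)
    (τ : Fin C.nTrans) (x : C.Val) :
    Integrable (fun y => MvPolynomial.eval y (p.inst t) +
      MvPolynomial.eval (C.proj y) (f.inst t)) (C.next τ x) := by
  simp only [← eval_inst_add_liftOut]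
  exact (integrable_eval_and_integral_eval hmom τ x _).1

theorem isUESM_of_valid (hmom : C.FiniteMoments) {I : C.Loc → LinPred C.nVar} {f : SymPoly T m}
    {η : C.Loc → SymPoly T C.nVar} (h : ∀ e ∈ C.uesmConstraints I f η, e.Valid t) :
    C.IsUESM I (fun y => MvPolynomial.eval y (f.inst t))
      (fun ℓ x => MvPolynomial.eval x ((η ℓ).inst t)) where
  measurable_fun := measurable_eval _
  measurable_state _ := measurable_eval _
  zero_on_output _ hx := eval_inst_eq_zero (fun e he => h e (List.mem_append_left _ he)) hx
  integrable τ x _ _ ℓ' _ := integrable_eval_inst hmom f (η ℓ') τ x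
  decrease τ x hx hg := by
    have h₁ := nonneg_of_valid_entail (P := (I (C.src τ)).and (C.guard τ)) (fun e he => h e
      (List.mem_append_right _ (List.mem_flatMap.2 ⟨τ, List.mem_finRange τ, he⟩))) ⟨hx, hg⟩
    rw [eval_inst_drift hmom] at h₁
    linarith

theorem isLESM_of_valid (hmom : C.FiniteMoments) {I : C.Loc → LinPred C.nVar} {f : SymPoly T m}
    {η : C.Loc → SymPoly T C.nVar} (h : ∀ e ∈ C.lesmConstraints I f η, e.Valid t) :
    C.IsLESM I (fun y => MvPolynomial.eval y (f.inst t))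
      (fun ℓ x => MvPolynomial.eval x ((η ℓ).inst t)) where
  measurable_fun := measurable_eval _
  measurable_state _ := measurable_eval _
  zero_on_output _ hx := eval_inst_eq_zero (fun e he => h e (List.mem_append_left _ he)) hx
  integrable τ x _ _ ℓ' _ := integrable_eval_inst hmom f (η ℓ') τ x
  increase τ x hx hg := by
    have h₁ := nonneg_of_valid_entail (P := (I (C.src τ)).and (C.guard τ)) (fun e he => h e
      (List.mem_append_right _ (List.mem_flatMap.2 ⟨τ, List.mem_finRange τ, he⟩))) ⟨hx, hg⟩
    rw [SymPoly.inst_neg, map_neg, eval_inst_drift hmom] at h₁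
    linarith

theorem abs_le_of_boundConstraints {I : C.Loc → LinPred C.nVar} {f : SymPoly T m}
    {η : C.Loc → SymPoly T C.nVar} {c : SymPoly T C.nVar} {c₀ : ℝ}
    (hc : ∀ x, MvPolynomial.eval x (c.inst t) = c₀)
    (h : ∀ e ∈ C.boundConstraints I f η c, e.Valid t) {s : C.State} (hs : (I s.1).Sat s.2) :
    |MvPolynomial.eval s.2 ((η s.1 + C.liftOut f).inst t)| ≤ c₀ := by
  have hmem : ∀ e ∈ entail (I s.1) (c - (η s.1 + C.liftOut f)) ++
      entail (I s.1) (c + (η s.1 + C.liftOut f)), e.Valid t := fun e he =>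
    h e (List.mem_flatMap.2 ⟨s.1, List.mem_finRange _, he⟩)
  have h₁ := nonneg_of_valid_entail (fun e he => hmem e (List.mem_append_left _ he)) hs
  have h₂ := nonneg_of_valid_entail (fun e he => hmem e (List.mem_append_right _ he)) hs
  rw [SymPoly.inst_sub, map_sub, hc] at h₁
  rw [SymPoly.inst_add c, map_add, hc] at h₂
  rw [abs_le]
  constructor <;> linarith

theorem eval_inst_changePoly (f : SymPoly T m) (η : C.Loc → SymPoly T C.nVar)
    (τ : Fin C.nTrans) (ℓ' : C.Loc) (z : Fin (C.nVar + 1) → ℝ) :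
    MvPolynomial.eval z ((C.changePoly f η τ ℓ').inst t) =
      MvPolynomial.eval (z ∘ Fin.castSucc) ((η (C.src τ) + C.liftOut f).inst t) -
        MvPolynomial.eval (fun i => MvPolynomial.eval z (C.nextPoly τ i))
          ((η ℓ' + C.liftOut f).inst t) := by
  simp only [SymPoly.eval_inst, changePoly, map_sub, mul_sub, Finset.sum_sub_distrib,
    MvPolynomial.eval_rename, Pi.add_apply]
  congr 1
  refine Finset.sum_congr rfl fun u _ => ?_
  simp only [MvPolynomial.eval, MvPolynomial.eval₂Hom_bind₁]

/-- Every possible step is realised by a point of the extended space: the current valuation followed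
by the sampled value, or by 0 if nothing is sampled and the last variable plays no role. -/
theorem exists_sat_stepPred {I : C.Loc → LinPred C.nVar} {S : Fin C.nTrans → LinPred 1}
    (hS : C.IsSupportDescription S) {τ : Fin C.nTrans} {x y : C.Val}
    (hx : (I (C.src τ)).Sat x) (hg : (C.guard τ).Sat x) (hy : y ∈ C.nextSupp τ x) :
    ∃ z : Fin (C.nVar + 1) → ℝ, z ∘ Fin.castSucc = x ∧ (C.stepPred I S τ).Sat z ∧
      (fun i => MvPolynomial.eval z (C.nextPoly τ i)) = y := by
  have hsnoc : ∀ a : ℝ, (Fin.snoc x a : Fin (C.nVar + 1) → ℝ) ∘ Fin.castSucc = x := fun a => by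
    funext i
    simp
  have hsat : ∀ a : ℝ, (((I (C.src τ)).and (C.guard τ)).rename Fin.castSucc).Sat
      (Fin.snoc x a : Fin (C.nVar + 1) → ℝ) := fun a => by
    rw [LinPred.sat_rename, hsnoc]
    exact ⟨hx, hg⟩
  unfold nextSupp at hy
  unfold stepPred nextPoly
  split at hy
  · rename_i hup
    simp only [hup]
    refine ⟨Fin.snoc x 0, hsnoc 0, hsat 0, ?_⟩
    rw [Set.mem_singleton_iff.1 hy]
    funext i
    simp
  · rename_i p hup
    simp only [hup]
    refine ⟨Fin.snoc x 0, hsnoc 0, hsat 0, ?_⟩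
    rw [Set.mem_singleton_iff.1 hy]
    funext i
    by_cases hi : i = (C.up τ).1
    · subst hi
      simp [MvPolynomial.eval_rename, hsnoc]
    · simp [Function.update_of_ne hi]
  · rename_i δ hδ
    obtain ⟨a, ha, rfl⟩ := hy
    simp only [hδ]
    refine ⟨Fin.snoc x a, hsnoc a, ⟨hsat a, ?_⟩, ?_⟩
    · rw [LinPred.sat_rename]
      have h := hS τ δ hδ a ha
      convert h using 1
      funext i
      simp
    · funext i
      by_cases hi : i = (C.up τ).1
      · subst hi
        simp
      · simp [Function.update_of_ne hi]

theorem abs_sub_le_of_changeConstraints {I : C.Loc → LinPred C.nVar}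
    {S : Fin C.nTrans → LinPred 1} (hS : C.IsSupportDescription S) {f : SymPoly T m}
    {η : C.Loc → SymPoly T C.nVar} {c : SymPoly T (C.nVar + 1)} {c₀ : ℝ}
    (hc : ∀ x, MvPolynomial.eval x (c.inst t) = c₀)
    (h : ∀ e ∈ C.changeConstraints I S f η c, e.Valid t) {s s' : C.State}
    (hs : (I s.1).Sat s.2) (hss' : C.Succ s s') :
    |MvPolynomial.eval s'.2 ((η s'.1 + C.liftOut f).inst t) -
      MvPolynomial.eval s.2 ((η s.1 + C.liftOut f).inst t)| ≤ c₀ := by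
  obtain ⟨τ, ⟨hsrc, hg⟩, hp, hn⟩ := hss'
  rw [← hsrc] at hs ⊢
  obtain ⟨z, hz, hsat, hnext⟩ := exists_sat_stepPred hS hs hg hn
  have hmem : ∀ e ∈ entail (C.stepPred I S τ) (c - C.changePoly f η τ s'.1) ++
      entail (C.stepPred I S τ) (c + C.changePoly f η τ s'.1), e.Valid t := fun e he => by
    refine h e (List.mem_flatMap.2 ⟨τ, List.mem_finRange _, List.mem_flatMap.2 ⟨s'.1, ?_, he⟩⟩)
    simpa using hp
  have h₁ := nonneg_of_valid_entail (fun e he => hmem e (List.mem_append_left _ he)) hsat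
  have h₂ := nonneg_of_valid_entail (fun e he => hmem e (List.mem_append_right _ he)) hsat
  rw [SymPoly.inst_sub, map_sub, hc, eval_inst_changePoly, hz, hnext] at h₁
  rw [SymPoly.inst_add, map_add, hc, eval_inst_changePoly, hz, hnext] at h₂
  rw [abs_le]
  constructor <;> linarith

end PCFG

theorem eval_inst_templateC {m : ℕ} (C₁ C₂ : PCFG m) (d n : ℕ) (t : TemplateVar C₁ C₂ d → ℝ)
    (x : Fin n → ℝ) : MvPolynomial.eval x ((templateC C₁ C₂ d n).inst t) =
      t (Sum.inr (Sum.inr (Sum.inr ()))) := by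
  simp [SymPoly.eval_inst, templateC]

theorem eval_inst_lt_of_refutationRow {m : ℕ} {C₁ C₂ : PCFG m} {d : ℕ} {A : Type} [Fintype A]
    {t : TemplateVar C₁ C₂ d ⊕ A → ℝ} (h : (refutationRow C₁ C₂ d A).Holds t) :
    MvPolynomial.eval C₁.xInit ((templateU C₁ C₂ d C₁.locInit +
        C₁.liftOut (templateF C₁ C₂ d)).inst (t ∘ Sum.inl)) <
      MvPolynomial.eval C₂.xInit ((templateL C₁ C₂ d C₂.locInit +
        C₂.liftOut (templateF C₁ C₂ d)).inst (t ∘ Sum.inl)) := by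
  rw [SymPoly.eval_inst, SymPoly.eval_inst, ← sub_pos, ← Finset.sum_sub_distrib]
  simp only [LinConstraint.Holds, refutationRow, Fintype.sum_sum_type (α₁ := TemplateVar C₁ C₂ d),
    zero_mul, Finset.sum_const_zero, add_zero] at h
  refine lt_of_lt_of_eq h (Finset.sum_congr rfl fun u _ => ?_)
  simp only [Function.comp, Pi.add_apply]
  ring

/-! ### Comparison of expectations and conclusion -/

namespace PCFG

/-- Under almost-sure termination the output distribution is the law of `output`, so output
equivalence is equality of two measures. -/
theorem integral_output_eq {m : ℕ} {C₁ C₂ : PCFG m} (hterm₁ : C₁.ASTerminating)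
    (hterm₂ : C₂.ASTerminating) (h : OutputEquivalent C₁ C₂) {f : (Fin m → ℝ) → ℝ}
    (hf : Measurable f) :
    ∫ ρ, f (C₁.output ρ) ∂C₁.runMeasure = ∫ ρ, f (C₂.output ρ) ∂C₂.runMeasure := by
  have hmap : C₁.runMeasure.map C₁.output = C₂.runMeasure.map C₂.output := by
    ext B hB
    rw [← outputDist_eq_map hterm₁ hB, ← outputDist_eq_map hterm₂ hB, h B hB]
  rw [← integral_map C₁.measurable_output.aemeasurable hf.aestronglyMeasurable, hmap,
    integral_map C₂.measurable_output.aemeasurable hf.aestronglyMeasurable]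

end PCFG

theorem theorem3 {m : ℕ} (C₁ C₂ : PCFG m)
    (hterm₁ : C₁.ASTerminating) (hterm₂ : C₂.ASTerminating)
    (hmom₁ : C₁.FiniteMoments) (hmom₂ : C₂.FiniteMoments)
    (I₁ : C₁.Loc → LinPred C₁.nVar) (I₂ : C₂.Loc → LinPred C₂.nVar)
    (hI₁ : C₁.IsInvariant I₁) (hI₂ : C₂.IsInvariant I₂)
    (S₁ : Fin C₁.nTrans → LinPred 1) (S₂ : Fin C₂.nTrans → LinPred 1)
    (hS₁ : C₁.IsSupportDescription S₁) (hS₂ : C₂.IsSupportDescription S₂)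
    (d K : ℕ)
    (f : MvPolynomial (Fin m) ℝ)
    (U : C₁.Loc → MvPolynomial (Fin C₁.nVar) ℝ)
    (L : C₂.Loc → MvPolynomial (Fin C₂.nVar) ℝ)
    (hret : AlgorithmReturns C₁ C₂ d I₁ I₂ S₁ S₂ K (.notOutputEquivalent f U L)) :
    ¬ PCFG.OutputEquivalent C₁ C₂ ∧
      C₁.IsUESM I₁ (fun y => MvPolynomial.eval y f) (fun ℓ x => MvPolynomial.eval x (U ℓ)) ∧
      C₂.IsLESM I₂ (fun y => MvPolynomial.eval y f) (fun ℓ x => MvPolynomial.eval x (L ℓ)) := by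
  cases hret with
  | success cond h₁ h₂ t ht =>
    have hvalid := valid_of_handelmanLP (es := collected C₁ C₂ d I₁ I₂ S₁ S₂ cond) (K := K)
      (t := t) fun c hc => ht c (Or.inl (Or.inl hc))
    have hlt := eval_inst_lt_of_refutationRow (ht _ (Or.inl (Or.inr rfl)))
    have hU := PCFG.isUESM_of_valid hmom₁ fun e he =>
      hvalid e (List.mem_append_left _ (List.mem_append_left _ he))
    have hL := PCFG.isLESM_of_valid hmom₂ fun e he =>
      hvalid e (List.mem_append_left _ (List.mem_append_right _ he))
    have host : ∀ e ∈ ostConstraints C₁ C₂ d I₁ I₂ S₁ S₂ cond, e.Valid (t ∘ Sum.inl) :=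
      fun e he => hvalid e (List.mem_append_right _ he)
    refine ⟨fun heq => ?_, hU, hL⟩
    have hdom₁ := PCFG.isDominated_of_admits hmom₁ h₁
      (fun ℓ => (templateU C₁ C₂ d ℓ + C₁.liftOut (templateF C₁ C₂ d)).inst (t ∘ Sum.inl))
      (by
        rintro rfl
        exact ⟨_, fun s hs => PCFG.abs_le_of_boundConstraints (eval_inst_templateC C₁ C₂ d _ _)
          (fun e he => host e (List.mem_append_left _ he)) (hI₁ s hs)⟩)
      (by
        rintro rfl
        exact ⟨_, fun s s' hs hss' => PCFG.abs_sub_le_of_changeConstraints hS₁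
          (eval_inst_templateC C₁ C₂ d _ _)
          (fun e he => host e (List.mem_append_left _ he)) (hI₁ s hs) hss'⟩)
    have hdom₂ := PCFG.isDominated_of_admits hmom₂ h₂
      (fun ℓ => (templateL C₁ C₂ d ℓ + C₂.liftOut (templateF C₁ C₂ d)).inst (t ∘ Sum.inl))
      (by
        rintro rfl
        exact ⟨_, fun s hs => PCFG.abs_le_of_boundConstraints (eval_inst_templateC C₁ C₂ d _ _)
          (fun e he => host e (List.mem_append_right _ he)) (hI₂ s hs)⟩)
      (by
        rintro rfl
        exact ⟨_, fun s s' hs hss' => PCFG.abs_sub_le_of_changeConstraints hS₂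
          (eval_inst_templateC C₁ C₂ d _ _)
          (fun e he => host e (List.mem_append_right _ he)) (hI₂ s hs) hss'⟩)
    -- This splits the evaluated sum into its two summands, the form of `value`, to which the
    -- optional stopping theorems apply.
    simp only [PCFG.eval_inst_add_liftOut] at hdom₁ hdom₂ hlt
    have hle₁ := hU.integral_output_le hterm₁ hI₁ hdom₁
    have hle₂ := hL.le_integral_output hterm₂ hI₂ hdom₂
    -- The common expectation of `f` now separates the two initial values in the order opposite to
    -- `hlt`.
    rw [PCFG.integral_output_eq hterm₁ hterm₂ heq hU.measurable_fun] at hle₁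
    exact absurd (hle₂.trans hle₁) (not_le.2 hlt)
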